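/- **Setting.** A weighted graph is a finite vertex set $V=V_{\max}\uplus V_{\min}$, a set of edges $E\subseteq V\times V$ such that every vertex has a successor, and a weight function $\omega\colon E\to\mathbb Z$; put $W=\max_{e\in E}|\omega(e)|$. A strategy of Max (resp. Min) maps each finite sequence $v_0\cdots v_i$ with $v_i\in V_{\max}$ (resp. $v_i\in V_{\min}$) to a successor of $v_i$. Two strategies $\sigma$ (of Max) and $\tau$ (of Min) and a start vertex $v$ determine an infinite play $\mathrm{Play}(v,\sigma,\tau)$. For a payoff function $P$ on infinite plays with values in $\mathbb Z\cup\{\pm\infty\}$, the lower value of $v$ is $\sup_\sigma\inf_\tau P(\mathrm{Play}(v,\sigma,\tau))$ and the upper value is $\inf_\tau\sup_\sigma P(\mathrm{Play}(v,\sigma,\tau))$. The game is determined if the two agree at every vertex; their common value is then $\mathrm{Val}(v)$. In the total-payoff game $\mathcal G$ on such a graph the payoff of $v_0v_1v_2\cdots$ is $\liminf_{n\to\infty}\sum_{i<n}\omega(v_i,v_{i+1})$. In a min-cost reachability (MCR) game with target $t$, the payoff of a play is $\sum_{i<n}\omega(v_i,v_{i+1})$ where $n$ is the first index with $v_n=t$,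 and $+\infty$ if there is no such index. For $k\ge1$ the MCR game $\mathcal G^k$ has as vertices a fresh target $t$ and, for $v\in V$ and $1\le j\le k$, vertices $(v,j)$, $(\mathrm{in},v,j)$, $(\mathrm{ex},v,j)$. The vertex $(v,j)$ belongs to the owner of $v$, the vertices $(\mathrm{in},v,j)$ belong to Min, and the vertices $(\mathrm{ex},v,j)$ and $t$ belong to Max. The edges are: $(v,j)\to(\mathrm{in},v',j)$ for $(v,v')\in E$, with weight $\omega(v,v')$; and, with weight $0$, $(\mathrm{in},v,j)\to(v,j)$, $(\mathrm{in},v,j)\to(\mathrm{ex},v,j)$ (Min requests to stop), $(\mathrm{ex},v,j)\to t$ (Max accepts), $(\mathrm{ex},v,j)\to(v,j-1)$ if $j>1$ (Max vetoes), and $t\to t$. **Proposition.** Let $K=|V|\,(2(|V|-1)W+1)$. For every $k\ge K$, the games $\mathcal G$ and $\mathcal G^k$ are determined, and for every $v\in V$: 1. $\mathrm{Val}_{\mathcal G}(v)\neq+\infty$ if and only if $\mathrm{Val}_{\mathcal G}(v)=\mathrm{Val}_{\mathcal G^k}((v,k))$; 2. $\mathrm{Val}_{\mathcal G}(v)=+\infty$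 if and only if $\mathrm{Val}_{\mathcal G^k}((v,k))\ge(|V|-1)W+1$. (If $V=\emptyset$ then $K=0$ and everything is vacuous or trivial; $\mathcal G^0$ then consists of $t$ alone.) -/

import Mathlib

/-- A deadlock-free weighted graph whose vertices are partitioned between the players Max
(`maxVertices`) and Min (the complement). Only the values of `weight` on edges matter. -/
structure WeightedGraph (V : Type*) where
  maxVertices : Set V
  Edge : V → V → Prop
  weight : V → V → ℤ
  deadlockFree : ∀ v, ∃ v', Edge v v'

namespace WeightedGraph

variable {V : Type*} (G : WeightedGraph V)

/-- The vertices of Min. -/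
def minVertices : Set V := G.maxVerticesᶜ

open Classical in
/-- `W`: the greatest absolute value of the weight of an edge. -/
noncomputable def maxAbsWeight [Fintype V] : ℕ :=
  (Finset.univ.filter fun e : V × V => G.Edge e.1 e.2).sup fun e => (G.weight e.1 e.2).natAbs

/-- The total payoff `TP(π[k])` of the finite prefix `π 0, …, π k` of a play. -/
def prefixPayoff (π : ℕ → V) (k : ℕ) : ℤ :=
  ∑ i ∈ Finset.range k, G.weight (π i) (π (i + 1))

/-- The total payoff of an infinite play: the limit inferior of those of its prefixes. -/
noncomputable def totalPayoff (π : ℕ → V) : EReal :=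
  Filter.liminf (fun k => ((G.prefixPayoff π k : ℝ) : EReal)) Filter.atTop

open Classical in
/-- The min-cost reachability payoff with target set `T`: `+∞` if the play avoids `T`, and
otherwise the total payoff of the prefix up to the first visit of `T`. -/
noncomputable def minCostReach (T : Set V) (π : ℕ → V) : EReal :=
  if h : ∃ k, π k ∈ T then ((G.prefixPayoff π (Nat.find h) : ℝ) : EReal) else ⊤

/-- A strategy of the player owning the vertices `S`: to a history `v₀ ⋯ vₖ` with `vₖ ∈ S`, given
as the list `[v₀, …, vₖ₋₁]` and the last vertex `vₖ`, it assigns a successor of `vₖ`. -/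
def Strategy (S : Set V) : Type _ := List V → (v : S) → {w : V // G.Edge v w}

/-- Strategies of Max. -/
abbrev MaxStrategy : Type _ := G.Strategy G.maxVertices

/-- Strategies of Min. -/
abbrev MinStrategy : Type _ := G.Strategy G.minVertices

variable {G}

open Classical in
/-- The vertex chosen after the history `h` followed by the current vertex `v`. -/
noncomputable def nextVertex (σ : G.MaxStrategy) (τ : G.MinStrategy) (h : List V) (v : V) : V :=
  if hv : v ∈ G.maxVertices then σ h ⟨v, hv⟩ else τ h ⟨v, hv⟩

/-- The history (without its last vertex) and the current vertex after `n` moves from `v`. -/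
noncomputable def outcomeState (v : V) (σ : G.MaxStrategy) (τ : G.MinStrategy) : ℕ → List V × V
  | 0 => ([], v)
  | n + 1 =>
    ((outcomeState v σ τ n).1 ++ [(outcomeState v σ τ n).2],
      nextVertex σ τ (outcomeState v σ τ n).1 (outcomeState v σ τ n).2)

/-- The play from `v` that conforms to `σ` and `τ`. -/
noncomputable def outcome (v : V) (σ : G.MaxStrategy) (τ : G.MinStrategy) (n : ℕ) : V :=
  (outcomeState v σ τ n).2

variable (G)

/-- The lower value of `v`: what Max can guarantee. -/
noncomputable def lowerValue (payoff : (ℕ → V) → EReal) (v : V) : EReal :=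
  ⨆ σ : G.MaxStrategy, ⨅ τ : G.MinStrategy, payoff (outcome v σ τ)

/-- The upper value of `v`: what Min can guarantee. -/
noncomputable def upperValue (payoff : (ℕ → V) → EReal) (v : V) : EReal :=
  ⨅ τ : G.MinStrategy, ⨆ σ : G.MaxStrategy, payoff (outcome v σ τ)

/-- The game is determined: lower and upper values agree at every vertex. -/
def Determined (payoff : (ℕ → V) → EReal) : Prop :=
  ∀ v, G.lowerValue payoff v = G.upperValue payoff v

/-- The value of `v`. It is meant for determined games, where it is the common value of
`lowerValue` and `upperValue`. -/
noncomputable def value (payoff : (ℕ → V) → EReal) (v : V) : EReal :=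
  G.lowerValue payoff v

/-- The vertices of the layered game with `n` layers, the layers being numbered `1, …, n`. -/
inductive LayeredVertex (V : Type*) (n : ℕ) : Type _
  /-- the vertex `(v, j)` -/
  | copy (v : V) (j : Set.Icc 1 n)
  /-- the interior vertex `(in, v, j)`, where Min may request to stop -/
  | interior (v : V) (j : Set.Icc 1 n)
  /-- the exterior vertex `(ex, v, j)`, where Max accepts, or (if `1 < j`) vetoes -/
  | exterior (v : V) (j : Set.Icc 1 n)
  /-- the fresh target vertex -/
  | target

/-- The edges of the layered game. -/
def LayeredEdge (n : ℕ) : LayeredVertex V n → LayeredVertex V n → Prop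
  | .target, .target => True
  | .copy v j, .interior v' j' => G.Edge v v' ∧ j' = j
  | .interior v j, .copy v' j' => v' = v ∧ j' = j
  | .interior v j, .exterior v' j' => v' = v ∧ j' = j
  | .exterior _ _, .target => True
  | .exterior v j, .copy v' j' => v' = v ∧ (j' : ℕ) + 1 = j
  | _, _ => False

/-- The weighted graph of the layered game with `n` layers. -/
def layered (n : ℕ) : WeightedGraph (LayeredVertex V n) where
  maxVertices := {x | match x with
    | .copy v _ => v ∈ G.maxVertices
    | .interior _ _ => False
    | .exterior _ _ => True
    | .target => True}
  Edge := G.LayeredEdge n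
  weight
    | .copy v _, .interior v' _ => G.weight v v'
    | _, _ => 0
  deadlockFree
    | .copy v j => (G.deadlockFree v).elim fun v' h => ⟨.interior v' j, h, rfl⟩
    | .interior v j => ⟨.copy v j, rfl, rfl⟩
    | .exterior _ _ => ⟨.target, trivial⟩
    | .target => ⟨.target, trivial⟩

/-- The payoff of the layered game: min-cost reachability of the fresh target. -/
noncomputable def layeredPayoff (n : ℕ) : (ℕ → LayeredVertex V n) → EReal :=
  (G.layered n).minCostReach {LayeredVertex.target}

/-- `K = |V| (2 (|V| - 1) W + 1)`; the truncated subtraction is harmless. -/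
noncomputable def layerBound [Fintype V] : ℕ :=
  Fintype.card V * (2 * (Fintype.card V - 1) * G.maxAbsWeight + 1)

theorem one_le_of_layerBound_le [Fintype V] (v : V) {k : ℕ} (hk : G.layerBound ≤ k) : 1 ≤ k :=
  le_trans (Nat.mul_pos (Fintype.card_pos_iff.mpr ⟨v⟩) (Nat.succ_pos _)) hk

/-- The vertex `(v, k)` in the first layer to be played of the game with `k ≥ K` layers. -/
def topCopy [Fintype V] (v : V) {k : ℕ} (hk : G.layerBound ≤ k) : LayeredVertex V k :=
  .copy v ⟨k, G.one_le_of_layerBound_le v hk, le_rfl⟩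

end WeightedGraph

/-!
Outside the region where the total payoff is infinite, the game and its layered version have the
same value because both are computed by iterating one operator. The value of the layered game at
`(v, j)` is `layerValue j v`: with `layerValue 0 = ⊥`, the function `layerValue (j + 1)` is the
greatest fixed point `stopValue` of a one-round operator `bellman`, in the game where Min may stop
at a vertex `w` for the price `max 0 (layerValue j w)` (`value_layered`). These values increase
with `j`; let `Y` be their supremum, except that `Y = ⊤` on a set `A` still to be described. It
turns out that `Y` is the value of the total-payoff game.

*The set `A`.* Optimal memoryless strategies of the discounted games, with discount factors tending
to `1`, yield `exists_cycle_partition`: on `A` Max has a memoryless strategy that stays in `A` and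
makes all cycles positive, and off `A` Min has one that stays outside and makes all cycles
nonpositive. The latter bounds the values of all layers off `A` by the weight of a simple path,
`(|V| - 1) W`. So these integers become stationary, and `Y < ⊤` off `A`.

*Max guarantees `Y`.* Off `A` let Max play optimally in the first layer whose value has reached `Y`.
The resulting memoryless strategy has `Y` as a potential, its cycles are nonnegative where
`Y ≠ ⊥`, and positive where `Y > 0` (`IsCertificate`, `exists_isCertificate`). Hence if `c ≤ Y v`,
along a play from `v` no pair of a vertex and a payoff below `c` can occur twice, and the payoffs
are at least `-(|V| - 1) W`. In the total-payoff game this means that the payoff is eventually at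
least `c` (`IsCertificate.le_lowerValue_totalPayoff`). In the layered game it means that Max, who
vetoes while the payoff is below `c`, does not run out of layers: for `c ≤ (|V| - 1) W + 1` there
are `K` pairs, and the initial one is not used up by a veto (`IsCertificate.le_layerValue`).

*Min guarantees `Y` off `A`.* There Min plays the stopping game of a layer in which all values are
stable off `A` and large on `A`, beginning anew whenever stopping pays off, and falls back on the
memoryless strategy with nonpositive cycles as soon as the payoff is low enough
(`upperValue_totalPayoff_le`).
-/

namespace WeightedGraph

/-! ### Extended integers -/

/-- The order isomorphism `x ↦ a + x` of the extended reals. -/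
noncomputable def intShift (a : ℤ) : EReal ≃o EReal where
  toFun x := ((a : ℝ) : EReal) + x
  invFun x := ((-a : ℝ) : EReal) + x
  left_inv x := by
    show ((-a : ℝ) : EReal) + (((a : ℝ) : EReal) + x) = x
    rw [← add_assoc, ← EReal.coe_add]; simp
  right_inv x := by
    show ((a : ℝ) : EReal) + (((-a : ℝ) : EReal) + x) = x
    rw [← add_assoc, ← EReal.coe_add]; simp
  map_rel_iff' {x y} := by
    show ((a : ℝ) : EReal) + x ≤ ((a : ℝ) : EReal) + y ↔ x ≤ y
    refine ⟨fun h => ?_, fun h => add_le_add le_rfl h⟩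
    have h' := add_le_add (le_refl ((-a : ℝ) : EReal)) h
    rw [← add_assoc, ← add_assoc, ← EReal.coe_add] at h'
    simpa using h'

theorem intShift_apply (a : ℤ) (x : EReal) : intShift a x = ((a : ℝ) : EReal) + x := rfl

theorem intShift_intShift (a b : ℤ) (x : EReal) :
    intShift a (intShift b x) = intShift (a + b) x := by
  simp only [intShift_apply, ← add_assoc, ← EReal.coe_add]; push_cast; rfl

@[simp] theorem intShift_zero (x : EReal) : intShift 0 x = x := by simp [intShift_apply]

@[simp] theorem intShift_coe (a b : ℤ) :
    intShift a ((b : ℝ) : EReal) = (((a + b : ℤ) : ℝ) : EReal) := by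
  simp only [intShift_apply, ← EReal.coe_add]; push_cast; rfl

theorem intShift_le_iff {a : ℤ} {x y : EReal} : intShift a x ≤ y ↔ x ≤ intShift (-a) y := by
  rw [← (intShift (-a)).le_iff_le, intShift_intShift]; simp

theorem le_intShift_iff {a : ℤ} {x y : EReal} : x ≤ intShift a y ↔ intShift (-a) x ≤ y := by
  rw [← (intShift (-a)).le_iff_le, intShift_intShift]; simp

theorem intShift_lt_iff {a : ℤ} {x y : EReal} : intShift a x < y ↔ x < intShift (-a) y := by
  rw [← (intShift (-a)).lt_iff_lt, intShift_intShift]; simp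

theorem coe_int_le {a b : ℤ} : ((a : ℝ) : EReal) ≤ ((b : ℝ) : EReal) ↔ a ≤ b := by
  simp

theorem coe_int_lt {a b : ℤ} : ((a : ℝ) : EReal) < ((b : ℝ) : EReal) ↔ a < b := by
  simp

/-- `x` is an integer or infinite, expressed by the absence of gaps between integers; this form
is visibly stable under infima and suprema. -/
def IsExtInt (x : EReal) : Prop := ∀ c : ℤ, x ≤ ((c : ℝ) : EReal) ∨ (((c + 1 : ℤ) : ℝ) : EReal) ≤ x

theorem IsExtInt.top : IsExtInt ⊤ := fun _ => .inr le_top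
theorem IsExtInt.bot : IsExtInt ⊥ := fun _ => .inl bot_le

theorem IsExtInt.zero : IsExtInt 0 := fun c => by
  have h0 : (0 : EReal) = (((0 : ℤ) : ℝ) : EReal) := by simp
  rw [h0, coe_int_le, coe_int_le]; omega

theorem IsExtInt.iInf {ι : Sort*} {f : ι → EReal} (h : ∀ i, IsExtInt (f i)) :
    IsExtInt (⨅ i, f i) := fun c => by
  by_cases hc : ∃ i, f i ≤ ((c : ℝ) : EReal)
  · obtain ⟨i, hi⟩ := hc
    exact .inl ((iInf_le f i).trans hi)
  · push Not at hc
    exact .inr (le_iInf fun i => (h i c).resolve_left (hc i).not_ge)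

theorem IsExtInt.iSup {ι : Sort*} {f : ι → EReal} (h : ∀ i, IsExtInt (f i)) :
    IsExtInt (⨆ i, f i) := fun c => by
  by_cases hc : ∀ i, f i ≤ ((c : ℝ) : EReal)
  · exact .inl (iSup_le hc)
  · push Not at hc
    obtain ⟨i, hi⟩ := hc
    exact .inr (((h i c).resolve_left hi.not_ge).trans (le_iSup f i))

theorem IsExtInt.min {x y : EReal} (hx : IsExtInt x) (hy : IsExtInt y) : IsExtInt (min x y) := by
  rcases min_choice x y with h | h <;> rw [h] <;> assumption

theorem IsExtInt.max {x y : EReal} (hx : IsExtInt x) (hy : IsExtInt y) : IsExtInt (max x y) := by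
  rcases max_choice x y with h | h <;> rw [h] <;> assumption

theorem IsExtInt.intShift {x : EReal} (hx : IsExtInt x) (a : ℤ) : IsExtInt (intShift a x) := by
  intro c
  rw [intShift_le_iff, intShift_coe, le_intShift_iff, intShift_coe]
  have := hx (-a + c)
  rwa [add_assoc] at this

theorem IsExtInt.eq_coe {x : EReal} (hx : IsExtInt x) (h : x ≠ ⊥) (h' : x ≠ ⊤) :
    ∃ c : ℤ, x = ((c : ℝ) : EReal) := by
  lift x to ℝ using ⟨h', h⟩
  refine ⟨⌊x⌋, ?_⟩
  rcases hx ⌊x⌋ with h1 | h1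
  · exact le_antisymm h1 (EReal.coe_le_coe_iff.2 (Int.floor_le x))
  · have := EReal.coe_le_coe_iff.1 h1
    push_cast at this
    exact absurd (Int.lt_floor_add_one x) this.not_gt

theorem IsExtInt.le_of_forall_le {x y : EReal} (hx : IsExtInt x) (hne : x ≠ ⊥)
    (h : ∀ c : ℤ, ((c : ℝ) : EReal) ≤ x → ((c : ℝ) : EReal) ≤ y) : x ≤ y := by
  by_cases ht : x = ⊤
  · subst ht
    refine (EReal.eq_top_iff_forall_lt y).2 (fun r => ?_) ▸ le_rfl
    refine lt_of_lt_of_le ?_ (h (⌊r⌋ + 1) le_top)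
    exact EReal.coe_lt_coe_iff.2 (by push_cast; exact Int.lt_floor_add_one r)
  · obtain ⟨c, rfl⟩ := hx.eq_coe hne ht
    exact h c le_rfl

theorem IsExtInt.le_of_forall_ge {x y : EReal} (hx : IsExtInt x) (hne : x ≠ ⊤)
    (h : ∀ c : ℤ, x ≤ ((c : ℝ) : EReal) → y ≤ ((c : ℝ) : EReal)) : y ≤ x := by
  by_cases ht : x = ⊥
  · subst ht
    refine (EReal.eq_bot_iff_forall_lt y).2 (fun r => ?_) ▸ le_rfl
    refine lt_of_le_of_lt (h (⌊r⌋ - 1) bot_le) ?_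
    refine EReal.coe_lt_coe_iff.2 ?_
    push_cast
    linarith [Int.floor_le r]
  · obtain ⟨c, rfl⟩ := hx.eq_coe ht hne
    exact h c le_rfl

/-- An infimum of extended integers that is at most an integer has a term that is. -/
theorem exists_le_of_iInf_le {ι : Sort*} {f : ι → EReal} (h : ∀ i, IsExtInt (f i)) {c : ℤ}
    (hc : ⨅ i, f i ≤ ((c : ℝ) : EReal)) : ∃ i, f i ≤ ((c : ℝ) : EReal) := by
  have : ⨅ i, f i < (((c + 1 : ℤ) : ℝ) : EReal) := hc.trans_lt (coe_int_lt.2 (by omega))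
  obtain ⟨i, hi⟩ := iInf_lt_iff.1 this
  exact ⟨i, (h i c).resolve_right hi.not_ge⟩

/-! ### One round of the game -/

section Stopping

variable {V : Type*} (G : WeightedGraph V)

open Classical in
/-- One round of the game: the owner of `v` picks an edge `v → w`, and its weight is added to the
continuation value `φ w`. -/
noncomputable def bellman (φ : V → EReal) (v : V) : EReal :=
  if v ∈ G.maxVertices then ⨆ w : {w // G.Edge v w}, intShift (G.weight v w) (φ w)
  else ⨅ w : {w // G.Edge v w}, intShift (G.weight v w) (φ w)

variable {G}

theorem le_bellman_of_mem {φ : V → EReal} {v w : V} (hv : v ∈ G.maxVertices) (h : G.Edge v w) :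
    intShift (G.weight v w) (φ w) ≤ G.bellman φ v := by
  rw [bellman, if_pos hv]
  exact le_iSup (fun w : {w // G.Edge v w} => intShift (G.weight v w) (φ w)) ⟨w, h⟩

theorem bellman_le_of_notMem {φ : V → EReal} {v w : V} (hv : v ∉ G.maxVertices)
    (h : G.Edge v w) : G.bellman φ v ≤ intShift (G.weight v w) (φ w) := by
  rw [bellman, if_neg hv]
  exact iInf_le (fun w : {w // G.Edge v w} => intShift (G.weight v w) (φ w)) ⟨w, h⟩

theorem exists_bellman_eq [Finite V] (G : WeightedGraph V) (φ : V → EReal) (v : V) :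
    ∃ w, G.Edge v w ∧ G.bellman φ v = intShift (G.weight v w) (φ w) := by
  have : Nonempty {w // G.Edge v w} := let ⟨w, hw⟩ := G.deadlockFree v; ⟨⟨w, hw⟩⟩
  by_cases hv : v ∈ G.maxVertices
  · obtain ⟨w, hw⟩ := exists_eq_ciSup_of_finite
      (f := fun w : {w // G.Edge v w} => intShift (G.weight v w) (φ w))
    exact ⟨w, w.2, by rw [bellman, if_pos hv, ← hw]⟩
  · obtain ⟨w, hw⟩ := exists_eq_ciInf_of_finite
      (f := fun w : {w // G.Edge v w} => intShift (G.weight v w) (φ w))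
    exact ⟨w, w.2, by rw [bellman, if_neg hv, ← hw]⟩

theorem le_bellman {φ : V → EReal} {v : V} {a : EReal}
    (h : ∀ w, G.Edge v w → a ≤ intShift (G.weight v w) (φ w)) : a ≤ G.bellman φ v := by
  by_cases hv : v ∈ G.maxVertices
  · obtain ⟨w, hw⟩ := G.deadlockFree v
    exact (h w hw).trans (le_bellman_of_mem hv hw)
  · rw [bellman, if_neg hv]
    exact le_iInf fun w => h w w.2

theorem bellman_mono (G : WeightedGraph V) : Monotone G.bellman := by
  intro φ ψ h v
  unfold bellman
  split_ifs
  · exact iSup_mono fun w => (intShift _).monotone (h w)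
  · exact iInf_mono fun w => (intShift _).monotone (h w)

theorem IsExtInt.bellman {φ : V → EReal} (h : ∀ v, IsExtInt (φ v)) (v : V) :
    IsExtInt (G.bellman φ v) := by
  unfold WeightedGraph.bellman
  split_ifs
  · exact .iSup fun w => (h w).intShift _
  · exact .iInf fun w => (h w).intShift _

/-- By finiteness of the graph, a round commutes with decreasing limits of continuation values. -/
theorem iInf_bellman_le [Finite V] {φ : ℕ → V → EReal} (hφ : Antitone φ) (v : V) :
    ⨅ n, G.bellman (φ n) v ≤ G.bellman (⨅ n, φ n) v := by
  by_contra! hlt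
  by_cases hv : v ∈ G.maxVertices
  · have key : ∀ w, ∃ n, G.Edge v w →
        intShift (G.weight v w) (φ n w) < ⨅ n, G.bellman (φ n) v := by
      intro w
      by_cases hw : G.Edge v w
      · have h1 := (le_bellman_of_mem hv hw).trans_lt hlt
        rw [intShift_lt_iff, iInf_apply, iInf_lt_iff] at h1
        obtain ⟨n, hn⟩ := h1
        exact ⟨n, fun _ => intShift_lt_iff.2 hn⟩
      · exact ⟨0, fun h => absurd h hw⟩
    choose N hN using key
    obtain ⟨M, hM⟩ := (Set.finite_range N).bddAbove
    obtain ⟨w, hw, he⟩ := exists_bellman_eq G (φ M) v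
    have h2 := (iInf_le (fun n => G.bellman (φ n) v) M).trans he.le
    have h3 := (intShift (G.weight v w)).monotone (hφ (hM ⟨w, rfl⟩) w)
    exact (h2.trans h3).not_gt (hN w hw)
  · obtain ⟨w, hw, he⟩ := exists_bellman_eq G (⨅ n, φ n) v
    rw [he, intShift_lt_iff, iInf_apply, iInf_lt_iff] at hlt
    obtain ⟨n, hn⟩ := hlt
    have h2 := (iInf_le (fun n => G.bellman (φ n) v) n).trans (bellman_le_of_notMem hv hw)
    exact h2.not_gt (intShift_lt_iff.2 hn)

section Iteration

variable {Ψ : (V → EReal) → V → EReal}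

/-- The limit of the decreasing iterates of `Ψ` that start from `⊤`. For monotone `Ψ` that commutes
with decreasing limits it is the greatest fixed point. -/
noncomputable def iterLimit (Ψ : (V → EReal) → V → EReal) : V → EReal := ⨅ n, Ψ^[n] ⊤

theorem antitone_iterate_top (hΨ : Monotone Ψ) : Antitone fun n => Ψ^[n] ⊤ := by
  refine antitone_nat_of_succ_le fun n => ?_
  rw [Function.iterate_succ_apply]
  exact hΨ.iterate n le_top

theorem map_iterLimit_le (hΨ : Monotone Ψ) : Ψ (iterLimit Ψ) ≤ iterLimit Ψ := by
  refine le_iInf fun n => ?_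
  cases n with
  | zero => exact le_top
  | succ n =>
    rw [Function.iterate_succ_apply']
    exact hΨ (iInf_le _ n)

theorem iterLimit_le_map (hΨ : Monotone Ψ)
    (hc : ∀ φ : ℕ → V → EReal, Antitone φ → ⨅ n, Ψ (φ n) ≤ Ψ (⨅ n, φ n)) :
    iterLimit Ψ ≤ Ψ (iterLimit Ψ) := by
  refine le_trans (le_iInf fun n => ?_) (hc _ (antitone_iterate_top hΨ))
  rw [← Function.iterate_succ_apply' Ψ]
  exact iInf_le _ (n + 1)

theorem le_iterLimit (hΨ : Monotone Ψ) {u : V → EReal} (hu : u ≤ Ψ u) : u ≤ iterLimit Ψ := by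
  refine le_iInf fun n => ?_
  induction n with
  | zero => exact le_top
  | succ n ih =>
    rw [Function.iterate_succ_apply']
    exact hu.trans (hΨ ih)

end Iteration

/-! ### Stopping games -/

variable (G)

/-- One round of the game in which Min may stop at any vertex `w` reached, at the cost `E w`. -/
noncomputable def stopStep (E : V → EReal) (x : V → EReal) : V → EReal := G.bellman (x ⊓ E)

/-- The value of the game in which Min has to stop eventually, and stopping in `w` costs `E w`. -/
noncomputable def stopValue (E : V → EReal) : V → EReal := iterLimit (G.stopStep E)

variable {G}

theorem stopStep_mono {E E' x x' : V → EReal} (hE : E ≤ E') (hx : x ≤ x') :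
    G.stopStep E x ≤ G.stopStep E' x' := G.bellman_mono (inf_le_inf hx hE)

theorem monotone_stopStep (E : V → EReal) : Monotone (G.stopStep E) :=
  fun _ _ h => stopStep_mono le_rfl h

theorem stopValue_eq [Finite V] (E : V → EReal) :
    G.stopStep E (G.stopValue E) = G.stopValue E := by
  refine le_antisymm (map_iterLimit_le (monotone_stopStep E))
    (iterLimit_le_map (monotone_stopStep E) fun φ hφ v => ?_)
  rw [iInf_apply]
  refine (iInf_bellman_le (φ := fun n => φ n ⊓ E)
    (fun m n h => inf_le_inf (hφ h) le_rfl) v).trans (G.bellman_mono ?_ v)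
  rw [iInf_inf]

theorem le_stopValue {E u : V → EReal} (hu : u ≤ G.stopStep E u) : u ≤ G.stopValue E :=
  le_iterLimit (monotone_stopStep E) hu

theorem stopValue_mono [Finite V] {E E' : V → EReal} (h : E ≤ E') :
    G.stopValue E ≤ G.stopValue E' :=
  le_stopValue ((stopValue_eq E).ge.trans (stopStep_mono h le_rfl))

theorem isExtInt_iterate_stopStep {E : V → EReal} (hE : ∀ v, IsExtInt (E v)) (n : ℕ) (v : V) :
    IsExtInt ((G.stopStep E)^[n] ⊤ v) := by
  induction n generalizing v with
  | zero => exact .top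
  | succ n ih =>
    rw [Function.iterate_succ_apply']
    exact IsExtInt.bellman (fun w => (ih w).min (hE w)) v

theorem stopValue_apply (E : V → EReal) (v : V) :
    G.stopValue E v = ⨅ n, (G.stopStep E)^[n] ⊤ v := by
  rw [stopValue, iterLimit, iInf_apply]

variable (G)

/-- The value of `(v, j)` in the layered games, described by recursion on `j` through stopping
games: where Min asks to stop, Max chooses between accepting and the value one layer below.
The value `⊥` of the missing layer `0` makes Max accept in the layer `1`. -/
noncomputable def layerValue : ℕ → V → EReal
  | 0 => ⊥
  | j + 1 => G.stopValue (0 ⊔ layerValue j)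

/-- The cost of asking to stop in layer `j + 1`. -/
noncomputable abbrev stopCost (j : ℕ) : V → EReal := 0 ⊔ G.layerValue j

variable {G}

theorem layerValue_mono [Finite V] : Monotone G.layerValue := by
  refine monotone_nat_of_le_succ fun n => ?_
  induction n with
  | zero => exact bot_le
  | succ n ih => exact stopValue_mono (sup_le_sup le_rfl ih)

theorem isExtInt_layerValue (j : ℕ) (v : V) : IsExtInt (G.layerValue j v) := by
  induction j generalizing v with
  | zero => exact .bot
  | succ j ih =>
    rw [layerValue, stopValue_apply]
    exact .iInf fun n => isExtInt_iterate_stopStep (fun w => IsExtInt.zero.max (ih w)) n v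

theorem isExtInt_stopCost (j : ℕ) (v : V) : IsExtInt (G.stopCost j v) :=
  IsExtInt.zero.max (isExtInt_layerValue j v)

theorem layerValue_succ_eq [Finite V] (j : ℕ) :
    G.layerValue (j + 1) = G.bellman (G.layerValue (j + 1) ⊓ G.stopCost j) :=
  (stopValue_eq (G.stopCost j)).symm

theorem layerValue_lt_top [Finite V] (j : ℕ) (v : V) : G.layerValue j v < ⊤ := by
  induction j generalizing v with
  | zero => exact bot_lt_top
  | succ j ih =>
    rw [layerValue_succ_eq]
    obtain ⟨w, -, he⟩ := exists_bellman_eq G (G.layerValue (j + 1) ⊓ G.stopCost j) v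
    rw [he, intShift_lt_iff]
    refine lt_of_lt_of_le (inf_le_right.trans_lt (max_lt EReal.zero_lt_top (ih w))) ?_
    exact (map_top (intShift _)).ge

end Stopping

/-! ### Plays and strategies -/

section Outcome

variable {V : Type*} {G : WeightedGraph V}

theorem outcome_succ (v : V) (σ : G.MaxStrategy) (τ : G.MinStrategy) (n : ℕ) :
    outcome v σ τ (n + 1) = nextVertex σ τ (outcomeState v σ τ n).1 (outcome v σ τ n) := rfl

theorem edge_outcome (v : V) (σ : G.MaxStrategy) (τ : G.MinStrategy) (n : ℕ) :
    G.Edge (outcome v σ τ n) (outcome v σ τ (n + 1)) := by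
  rw [outcome_succ, nextVertex]
  split_ifs
  · exact (σ (outcomeState v σ τ n).1 ⟨outcome v σ τ n, _⟩).2
  · exact (τ (outcomeState v σ τ n).1 ⟨outcome v σ τ n, _⟩).2

theorem length_outcomeState (v : V) (σ : G.MaxStrategy) (τ : G.MinStrategy) (n : ℕ) :
    (outcomeState v σ τ n).1.length = n := by
  induction n with
  | zero => rfl
  | succ n ih => simp [outcomeState, ih]

theorem prefixPayoff_zero (π : ℕ → V) : G.prefixPayoff π 0 = 0 := rfl

theorem prefixPayoff_succ (π : ℕ → V) (n : ℕ) :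
    G.prefixPayoff π (n + 1) = G.prefixPayoff π n + G.weight (π n) (π (n + 1)) :=
  Finset.sum_range_succ _ _

/-- The memoryless strategy of Max given by a choice of successors. -/
def memoryless (f : V → V) (hf : ∀ v, G.Edge v (f v)) : G.MaxStrategy := fun _ v => ⟨f v, hf v⟩

theorem outcome_memoryless {f : V → V} (hf : ∀ v, G.Edge v (f v)) (v : V) (τ : G.MinStrategy)
    {n : ℕ} (hn : outcome v (memoryless f hf) τ n ∈ G.maxVertices) :
    outcome v (memoryless f hf) τ (n + 1) = f (outcome v (memoryless f hf) τ n) := by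
  rw [outcome_succ, nextVertex, dif_pos hn]
  rfl

theorem lowerValue_le_upperValue (payoff : (ℕ → V) → EReal) (v : V) :
    G.lowerValue payoff v ≤ G.upperValue payoff v := iSup_iInf_le_iInf_iSup _

section Memory

variable {M : Type*}

/-- The memory reached from `m` along a path when each edge `a → b` updates it by `upd · a b`. -/
def runMemory (upd : M → V → V → M) : M → List V → M
  | m, [] => m
  | m, [_] => m
  | m, a :: b :: l => runMemory upd (upd m a b) (b :: l)

theorem runMemory_append (upd : M → V → V → M) (m : M) (l : List V) (a b : V) :
    runMemory upd m (l ++ [a] ++ [b]) = upd (runMemory upd m (l ++ [a])) a b := by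
  induction l generalizing m with
  | nil => rfl
  | cons c l ih =>
    cases l with
    | nil => rfl
    | cons d l => exact ih (upd m c d)

/-- Min may use a memory that is updated along the edges of the play. -/
theorem exists_minStrategy_of_memory (upd : M → V → V → M) (m₀ : M) (f : M → V → V)
    (hf : ∀ m v, G.Edge v (f m v)) :
    ∃ τ : G.MinStrategy, ∀ v σ, ∃ m : ℕ → M, m 0 = m₀ ∧
      (∀ n, m (n + 1) = upd (m n) (outcome v σ τ n) (outcome v σ τ (n + 1))) ∧
      ∀ n, outcome v σ τ n ∉ G.maxVertices →
        outcome v σ τ (n + 1) = f (m n) (outcome v σ τ n) := by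
  refine ⟨fun h v => ⟨f (runMemory upd m₀ (h ++ [v.1])) v, hf _ _⟩, fun v σ => ?_⟩
  set τ : G.MinStrategy := fun h v => ⟨f (runMemory upd m₀ (h ++ [v.1])) v, hf _ _⟩
  refine ⟨fun n => runMemory upd m₀ ((outcomeState v σ τ n).1 ++ [outcome v σ τ n]), rfl,
    fun n => runMemory_append upd m₀ _ _ _, fun n hn => ?_⟩
  rw [outcome_succ, nextVertex, dif_neg hn]

end Memory

/-! ### Min-cost reachability -/

variable (G) in
open Classical in
/-- One round of the min-cost reachability game with targets `T`. -/
noncomputable def reachStep (T : Set V) (x : V → EReal) (v : V) : EReal :=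
  if v ∈ T then 0 else G.bellman x v

theorem monotone_reachStep (T : Set V) : Monotone (G.reachStep T) := by
  intro x y h v
  unfold reachStep
  split_ifs
  · exact le_rfl
  · exact G.bellman_mono h v

variable (G) in
/-- The limit of the values of the reachability games of bounded duration, in which Max receives
`⊤` if the time runs out. -/
noncomputable def reachLimit (T : Set V) : V → EReal := iterLimit (G.reachStep T)

theorem reachLimit_le [Finite V] (T : Set V) :
    G.reachLimit T ≤ G.reachStep T (G.reachLimit T) := by
  refine iterLimit_le_map (monotone_reachStep T) fun φ hφ v => ?_
  rw [iInf_apply]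
  unfold reachStep
  split_ifs
  · exact iInf_le _ 0
  · exact iInf_bellman_le hφ v

/-- Max guarantees every `u` that does not exceed what one round makes of it, by moving to
a successor that attains the maximum. -/
theorem le_lowerValue_minCostReach [Finite V] {T : Set V} {u : V → EReal}
    (hu : u ≤ G.reachStep T u) (v : V) : u v ≤ G.lowerValue (G.minCostReach T) v := by
  classical
  choose f hf hfe using exists_bellman_eq G u
  refine le_iSup_of_le (memoryless f hf) (le_iInf fun τ => ?_)
  set π := outcome v (memoryless f hf) τ with hπ
  have step : ∀ n, π n ∉ T → u (π n) ≤ intShift (G.weight (π n) (π (n + 1))) (u (π (n + 1))) := by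
    intro n hn
    refine (hu (π n)).trans ?_
    rw [reachStep, if_neg hn]
    by_cases hm : π n ∈ G.maxVertices
    · rw [hπ, outcome_memoryless hf v τ hm, ← hπ]
      exact (hfe _).le
    · exact bellman_le_of_notMem hm (edge_outcome _ _ _ _)
  have main : ∀ n, (∀ i < n, π i ∉ T) → u v ≤ intShift (G.prefixPayoff π n) (u (π n)) := by
    intro n
    induction n with
    | zero => intro _; rw [prefixPayoff_zero, intShift_zero]; exact le_rfl
    | succ n ih =>
      intro h
      rw [prefixPayoff_succ, ← intShift_intShift]
      exact (ih fun i hi => h i (by omega)).trans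
        ((intShift _).monotone (step n (h n (by omega))))
  unfold minCostReach
  split_ifs with hT
  · refine (main _ fun i hi => Nat.find_min hT hi).trans ?_
    have h1 := hu (π (Nat.find hT))
    rw [reachStep, if_pos (Nat.find_spec hT)] at h1
    refine ((intShift _).monotone h1).trans ?_
    simp [intShift_apply]
  · exact le_top

/-- Min guarantees the value of the game that lasts at most `n` rounds. -/
theorem upperValue_minCostReach_le_iterate [Finite V] (T : Set V) (n : ℕ) (v : V) :
    G.upperValue (G.minCostReach T) v ≤ (G.reachStep T)^[n] ⊤ v := by
  classical
  choose f hf hfe using fun m => exists_bellman_eq G ((G.reachStep T)^[m] ⊤)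
  refine iInf_le_of_le (fun h w => ⟨f (n - h.length - 1) w, hf _ _⟩) (iSup_le fun σ => ?_)
  set τ : G.MinStrategy := fun h w => ⟨f (n - h.length - 1) w, hf _ _⟩
  set π := outcome v σ τ with hπ
  have main : ∀ i ≤ n, (∀ j < i, π j ∉ T) →
      intShift (G.prefixPayoff π i) ((G.reachStep T)^[n - i] ⊤ (π i)) ≤
        (G.reachStep T)^[n] ⊤ v := by
    intro i
    induction i with
    | zero => intro _ _; rw [prefixPayoff_zero, intShift_zero]; exact le_rfl
    | succ i ih =>
      intro hi h
      refine le_trans ?_ (ih (by omega) fun j hj => h j (by omega))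
      rw [prefixPayoff_succ, ← intShift_intShift]
      refine (intShift _).monotone ?_
      obtain ⟨m, hm⟩ : ∃ m, n - i = m + 1 := ⟨n - i - 1, by omega⟩
      rw [hm, show n - (i + 1) = m by omega, Function.iterate_succ_apply', reachStep,
        if_neg (h i (by omega))]
      by_cases hmax : π i ∈ G.maxVertices
      · exact le_bellman_of_mem hmax (edge_outcome _ _ _ _)
      · have : π (i + 1) = f m (π i) := by
          rw [hπ, outcome_succ, nextVertex, dif_neg hmax]
          show f (n - (outcomeState v σ τ i).1.length - 1) _ = _
          rw [length_outcomeState, show n - i - 1 = m by omega]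
        rw [this]
        exact (hfe m _).ge
  have late : (∀ j < n, π j ∉ T) → (G.reachStep T)^[n] ⊤ v = ⊤ := by
    intro h
    have := main n le_rfl h
    rw [Nat.sub_self] at this
    simpa using this
  unfold minCostReach
  split_ifs with hT
  · by_cases hn : Nat.find hT ≤ n
    · refine le_trans ?_ (main _ hn fun j hj => Nat.find_min hT hj)
      have h0 : 0 ≤ (G.reachStep T)^[n - Nat.find hT] ⊤ (π (Nat.find hT)) := by
        cases n - Nat.find hT with
        | zero => exact le_top
        | succ m =>
          rw [Function.iterate_succ_apply', reachStep, if_pos (Nat.find_spec hT)]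
      refine le_trans ?_ ((intShift _).monotone h0)
      simp [intShift_apply]
    · rw [late fun j hj => Nat.find_min hT (by omega)]
      exact le_top
  · push Not at hT
    rw [late fun j _ => hT j]

theorem upperValue_minCostReach_le [Finite V] (T : Set V) (v : V) :
    G.upperValue (G.minCostReach T) v ≤ G.reachLimit T v := by
  rw [reachLimit, iterLimit, iInf_apply]
  exact le_iInf fun n => upperValue_minCostReach_le_iterate T n v

end Outcome

/-! ### The values of the layered games -/

section Layered

variable {V : Type*} (G : WeightedGraph V) {n : ℕ}

instance [Finite V] : Finite (LayeredVertex V n) := by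
  refine Finite.of_injective (β := Option (Fin 3 × V × Set.Icc 1 n)) (fun x => match x with
    | .copy v j => some (0, v, j)
    | .interior v j => some (1, v, j)
    | .exterior v j => some (2, v, j)
    | .target => none) ?_
  intro x y h
  cases x <;> cases y <;> simp_all

/-- The values of the layered game in terms of `layerValue`. -/
noncomputable def layeredValue : LayeredVertex V n → EReal
  | .copy v j => G.layerValue j v
  | .interior v j => min (G.layerValue j v) (G.stopCost (j - 1) v)
  | .exterior v j => G.stopCost (j - 1) v
  | .target => 0

theorem layeredValue_le_reachStep [Finite V] :
    G.layeredValue (n := n) ≤ (G.layered n).reachStep {.target} G.layeredValue := by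
  intro x
  unfold reachStep
  cases x with
  | target => simp [layeredValue]
  | exterior v j =>
    rw [if_neg (by simp)]
    have hm : (LayeredVertex.exterior v j) ∈ (G.layered n).maxVertices := trivial
    refine max_le ?_ ?_
    · refine le_trans ?_ (le_bellman_of_mem hm
        (show (G.layered n).Edge (.exterior v j) .target from trivial))
      exact (intShift_zero 0).ge
    · obtain ⟨j, hj1, hjn⟩ := j
      obtain ⟨i, rfl⟩ : ∃ i, j = i + 1 := ⟨j - 1, by omega⟩
      rcases Nat.eq_zero_or_pos i with rfl | hi
      · exact bot_le
      · refine le_trans ?_ (le_bellman_of_mem hm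
          (show (G.layered n).Edge (.exterior v ⟨i + 1, hj1, hjn⟩) (.copy v ⟨i, hi, by omega⟩) from
            ⟨rfl, rfl⟩))
        exact (intShift_zero _).ge
  | interior v j =>
    rw [if_neg (by simp)]
    refine le_bellman fun w hw => ?_
    cases w with
    | copy v' j' =>
      obtain ⟨rfl, rfl⟩ := hw
      exact (min_le_left _ _).trans (intShift_zero _).ge
    | exterior v' j' =>
      obtain ⟨rfl, rfl⟩ := hw
      exact (min_le_right _ _).trans (intShift_zero _).ge
    | interior v' j' => exact hw.elim
    | target => exact hw.elim
  | copy v j =>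
    rw [if_neg (by simp)]
    obtain ⟨j, hj1, hjn⟩ := j
    obtain ⟨i, rfl⟩ : ∃ i, j = i + 1 := ⟨j - 1, by omega⟩
    show G.layerValue (i + 1) v ≤ _
    rw [layerValue_succ_eq]
    by_cases hv : v ∈ G.maxVertices
    · obtain ⟨w, hw, he⟩ := exists_bellman_eq G (G.layerValue (i + 1) ⊓ G.stopCost i) v
      rw [he]
      exact le_bellman_of_mem (G := G.layered n) (φ := G.layeredValue)
        (v := .copy v ⟨i + 1, hj1, hjn⟩) (w := .interior w ⟨i + 1, hj1, hjn⟩) hv ⟨hw, rfl⟩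
    · refine le_bellman fun w hw => ?_
      cases w with
      | interior v' j' =>
        obtain ⟨hw, rfl⟩ := hw
        exact bellman_le_of_notMem hv hw
      | copy v' j' => exact hw.elim
      | exterior v' j' => exact hw.elim
      | target => exact hw.elim

theorem reachLimit_layered_le [Finite V] :
    (G.layered n).reachLimit {.target} ≤ G.layeredValue := by
  set I := (G.layered n).reachLimit {.target} with hI
  have hle := reachLimit_le (G := G.layered n) {.target}
  rw [← hI] at hle
  have htarget : I .target ≤ 0 := by
    have := hle .target
    rwa [reachStep, if_pos (by simp)] at this
  have hother : ∀ x, x ≠ .target → I x ≤ (G.layered n).bellman I x := by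
    intro x hx
    have := hle x
    rwa [reachStep, if_neg (by simpa using hx)] at this
  have hinterior : ∀ v j, I (.interior v j) ≤ min (I (.copy v j)) (I (.exterior v j)) := by
    intro v j
    have hm : (LayeredVertex.interior v j) ∉ (G.layered n).maxVertices := id
    refine le_min ?_ ?_
    · refine (hother _ (by simp)).trans
        ((bellman_le_of_notMem hm
          (show (G.layered n).Edge (.interior v j) (.copy v j) from ⟨rfl, rfl⟩)).trans ?_)
      exact (intShift_zero _).le
    · refine (hother _ (by simp)).trans
        ((bellman_le_of_notMem hm
          (show (G.layered n).Edge (.interior v j) (.exterior v j) from ⟨rfl, rfl⟩)).trans ?_)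
      exact (intShift_zero _).le
  have hexterior : ∀ v (j : Set.Icc 1 n),
      (∀ i : Set.Icc 1 n, (i : ℕ) + 1 = j → I (.copy v i) ≤ G.layerValue i v) →
      I (.exterior v j) ≤ G.stopCost (j - 1) v := by
    intro v j ih
    obtain ⟨w, hw, he⟩ := exists_bellman_eq (G.layered n) I (.exterior v j)
    refine (hother _ (by simp)).trans ?_
    rw [he]
    cases w with
    | target => exact (intShift_zero _).le.trans (htarget.trans le_sup_left)
    | copy v' j' =>
      obtain ⟨rfl, hj⟩ := hw
      refine (intShift_zero _).le.trans ((ih j' hj).trans ?_)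
      rw [← hj]
      exact le_sup_right
    | interior v' j' => exact hw.elim
    | exterior v' j' => exact hw.elim
  have hcopy : ∀ (i : ℕ) (hi : i ∈ Set.Icc 1 n) (v : V),
      I (.copy v ⟨i, hi⟩) ≤ G.layerValue i v := by
    intro i
    induction i with
    | zero => intro hi; exact absurd hi.1 (by omega)
    | succ i ih =>
      intro hi
      have hex : ∀ v, I (.exterior v ⟨i + 1, hi⟩) ≤ G.stopCost i v := by
        intro v
        refine hexterior v _ fun i' hi' => ?_
        obtain ⟨i', h'⟩ := i'
        obtain rfl : i' = i := by simpa using hi'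
        exact ih h' v
      refine le_stopValue (G := G) (E := G.stopCost i)
        (u := fun v => I (.copy v ⟨i + 1, hi⟩)) fun v => ?_
      have hint : ∀ w, I (.interior w ⟨i + 1, hi⟩) ≤
          ((fun v => I (.copy v ⟨i + 1, hi⟩)) ⊓ G.stopCost i) w :=
        fun w => (hinterior w _).trans (inf_le_inf le_rfl (hex w))
      refine (hother _ (by simp)).trans ?_
      by_cases hv : v ∈ G.maxVertices
      · obtain ⟨w, hw, he⟩ := exists_bellman_eq (G.layered n) I (.copy v ⟨i + 1, hi⟩)
        rw [he]
        cases w with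
        | interior v' j' =>
          obtain ⟨hw, rfl⟩ := hw
          exact ((intShift _).monotone (hint v')).trans (le_bellman_of_mem hv hw)
        | copy v' j' => exact hw.elim
        | exterior v' j' => exact hw.elim
        | target => exact hw.elim
      · refine le_bellman fun w hw => ?_
        refine le_trans ?_ ((intShift _).monotone (hint w))
        exact bellman_le_of_notMem (G := G.layered n) (φ := I)
          (v := .copy v ⟨i + 1, hi⟩) (w := .interior w ⟨i + 1, hi⟩) hv ⟨hw, rfl⟩
  have hex : ∀ v (j : Set.Icc 1 n), I (.exterior v j) ≤ G.stopCost (j - 1) v :=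
    fun v j => hexterior v j fun i _ => hcopy i i.2 v
  intro x
  cases x with
  | target => exact htarget
  | exterior v j => exact hex v j
  | interior v j => exact (hinterior v j).trans (min_le_min (hcopy j j.2 v) (hex v j))
  | copy v j => exact hcopy j j.2 v

theorem upperValue_layered_le [Finite V] (x : LayeredVertex V n) :
    (G.layered n).upperValue (G.layeredPayoff n) x ≤ G.layeredValue x :=
  (upperValue_minCostReach_le _ x).trans (G.reachLimit_layered_le x)

theorem value_layered [Finite V] (x : LayeredVertex V n) :
    (G.layered n).value (G.layeredPayoff n) x = G.layeredValue x :=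
  le_antisymm ((lowerValue_le_upperValue _ x).trans (G.upperValue_layered_le x))
    (le_lowerValue_minCostReach G.layeredValue_le_reachStep x)

theorem determined_layered [Finite V] : (G.layered n).Determined (G.layeredPayoff n) := fun x =>
  le_antisymm (lowerValue_le_upperValue _ x)
    ((G.upperValue_layered_le x).trans (G.value_layered x).ge)

end Layered

/-! ### Walks -/

section Walks

variable {V : Type*}

/-- `WalkOf R ω a b l p`: there is a walk from `a` to `b` along `R` of length `l` whose weights
`ω` sum up to `p`. -/
inductive WalkOf (R : V → V → Prop) (ω : V → V → ℤ) (a : V) : V → ℕ → ℤ → Prop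
  | nil : WalkOf R ω a a 0 0
  | snoc {b c l p} : WalkOf R ω a b l p → R b c → WalkOf R ω a c (l + 1) (p + ω b c)

variable {R R' : V → V → Prop} {ω : V → V → ℤ} {a b c : V} {l : ℕ} {p : ℤ}

theorem WalkOf.cast {p' : ℤ} (h : WalkOf R ω a b l p) (hp : p = p') : WalkOf R ω a b l p' :=
  hp ▸ h

theorem WalkOf.mono (h : WalkOf R ω a b l p) (hR : ∀ u v, R u v → R' u v) :
    WalkOf R' ω a b l p := by
  induction h with
  | nil => exact .nil
  | snoc _ hbc ih => exact ih.snoc (hR _ _ hbc)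

theorem WalkOf.neg (h : WalkOf R ω a b l p) : WalkOf R (fun u v => -ω u v) a b l (-p) := by
  induction h with
  | nil => exact .nil
  | snoc _ hbc ih => exact (ih.snoc hbc).cast (by ring)

theorem WalkOf.cons (hab : R a b) (h : WalkOf R ω b c l p) :
    WalkOf R ω a c (l + 1) (ω a b + p) := by
  induction h with
  | nil => exact ((WalkOf.nil).snoc hab).cast (by ring)
  | snoc _ hbc ih => exact (ih.snoc hbc).cast (by ring)

theorem WalkOf.restrict {P : V → Prop} (hP : ∀ u v, R u v → P u → P v) (ha : P a)
    (h : WalkOf R ω a b l p) : WalkOf (fun u v => R u v ∧ P u ∧ P v) ω a b l p ∧ P b := by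
  induction h with
  | nil => exact ⟨.nil, ha⟩
  | snoc _ hbc ih => exact ⟨ih.1.snoc ⟨hbc, ih.2, hP _ _ hbc ih.2⟩, hP _ _ hbc ih.2⟩

/-- Splitting a walk at its last visit to the initial vertex. -/
theorem WalkOf.exists_split (h : WalkOf R ω a b l p) :
    ∃ q r k, WalkOf R ω a a k q ∧ q + r = p ∧ ((b = a ∧ r = 0) ∨ b ≠ a ∧ ∃ a' k' r', R a a' ∧
      a' ≠ a ∧ r = ω a a' + r' ∧ WalkOf (fun u v => R u v ∧ u ≠ a ∧ v ≠ a) ω a' b k' r') := by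
  induction h with
  | nil => exact ⟨0, 0, 0, .nil, rfl, .inl ⟨rfl, rfl⟩⟩
  | @snoc b c l p hw hbc ih =>
    by_cases hc : c = a
    · subst hc
      exact ⟨_, 0, _, hw.snoc hbc, add_zero _, .inl ⟨rfl, rfl⟩⟩
    · obtain ⟨q, r, k, hq, rfl, ⟨rfl, rfl⟩ | ⟨hb, a', k', r', haa', ha', rfl, hw'⟩⟩ := ih
      · exact ⟨q, _, k, hq, by rw [add_zero], .inr ⟨hc, c, 0, 0, hbc, hc, (add_zero _).symm, .nil⟩⟩
      · exact ⟨q, _, k, hq, by rw [add_assoc],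
          .inr ⟨hc, a', _, _, haa', ha', by rw [add_assoc], hw'.snoc ⟨hbc, hb, hc⟩⟩⟩

/-- Induction on the number of vertices: the closed walk at the start is dropped, and what follows
the next edge avoids the initial vertex. -/
theorem WalkOf.neg_mul_le_of_card {W : ℕ} (n : ℕ) (S : Finset V) (hS : S.card = n + 1)
    (hRS : ∀ u v, R u v → u ∈ S ∧ v ∈ S)
    (hcyc : ∀ u k q, WalkOf R ω u u k q → 0 ≤ q) (hW : ∀ u v, R u v → -(W : ℤ) ≤ ω u v)
    (ha : a ∈ S) (h : WalkOf R ω a b l p) : -(n * W : ℤ) ≤ p := by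
  classical
  induction n generalizing S R a l p with
  | zero =>
    obtain ⟨q, r, k, hq, rfl, ⟨rfl, rfl⟩ | ⟨hb, a', k', r', haa', ha', rfl, hw'⟩⟩ := h.exists_split
    · simpa using hcyc _ _ _ hq
    · exact absurd (Finset.card_le_one.1 hS.le a' (hRS _ _ haa').2 a ha) ha'
  | succ n ih =>
    obtain ⟨q, r, k, hq, rfl, ⟨rfl, rfl⟩ | ⟨hb, a', k', r', haa', ha', rfl, hw'⟩⟩ := h.exists_split
    · have := hcyc _ _ _ hq
      have h2 : (0 : ℤ) ≤ ((n + 1 : ℕ) : ℤ) * W := by positivity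
      linarith
    · have h1 := ih (S.erase a) (by rw [Finset.card_erase_of_mem ha, hS]; rfl)
        (fun u v huv => ⟨Finset.mem_erase.2 ⟨huv.2.1, (hRS u v huv.1).1⟩,
          Finset.mem_erase.2 ⟨huv.2.2, (hRS u v huv.1).2⟩⟩)
        (fun u k q hq => hcyc u k q (hq.mono fun _ _ h => h.1))
        (fun u v huv => hW u v huv.1) (Finset.mem_erase.2 ⟨ha', (hRS _ _ haa').2⟩) hw'
      have h2 := hcyc _ _ _ hq
      have h3 := hW _ _ haa'
      push_cast
      linarith

/-- If closed walks have nonnegative weight, then a walk weighs no less than the worst simple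
path. -/
theorem WalkOf.neg_mul_le [Fintype V] {W : ℕ} {P : V → Prop} (hP : ∀ u v, R u v → P u → P v)
    (hcyc : ∀ u k q, P u → WalkOf R ω u u k q → 0 ≤ q) (hW : ∀ u v, R u v → -(W : ℤ) ≤ ω u v)
    (ha : P a) (h : WalkOf R ω a b l p) : -(((Fintype.card V - 1 : ℕ) * W : ℕ) : ℤ) ≤ p := by
  have hpos : 0 < Fintype.card V := Fintype.card_pos_iff.2 ⟨a⟩
  push_cast
  refine (h.restrict hP ha).1.neg_mul_le_of_card (Fintype.card V - 1) Finset.univ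
    (by rw [Finset.card_univ]; omega) (by simp) (fun u k q hq => ?_)
    (fun u v huv => hW u v huv.1) (Finset.mem_univ _)
  by_cases hu : P u
  · exact hcyc u k q hu (hq.mono fun _ _ h => h.1)
  · cases hq with
    | nil => exact le_rfl
    | snoc _ h => exact absurd h.2.2 hu

end Walks

section Weights

variable {V : Type*} (G : WeightedGraph V)

theorem abs_weight_le [Fintype V] {u v : V} (h : G.Edge u v) :
    |G.weight u v| ≤ G.maxAbsWeight := by
  classical
  rw [Int.abs_eq_natAbs, Nat.cast_le]
  exact Finset.le_sup (f := fun e : V × V => (G.weight e.1 e.2).natAbs) (b := (u, v)) (by simpa)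

/-- The moves that are possible when the owner of the vertices `S` plays according to `f`. -/
def Follows (S : Set V) (f : V → V) (u v : V) : Prop := G.Edge u v ∧ (u ∈ S → v = f u)

end Weights

/-! ### Positive and nonpositive cycles -/

section MeanPayoff

variable {V : Type*} [Fintype V] (G : WeightedGraph V)

open Classical in
/-- One round of the game with discount factor `r`. -/
noncomputable def discountedStep (r : ℝ) (x : V → ℝ) (v : V) : ℝ :=
  if v ∈ G.maxVertices then ⨆ w : {w // G.Edge v w}, ((G.weight v w : ℝ) + r * x w)
  else ⨅ w : {w // G.Edge v w}, ((G.weight v w : ℝ) + r * x w)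

variable {G}

theorem le_discountedStep {r : ℝ} {x : V → ℝ} {v w : V} (hv : v ∈ G.maxVertices)
    (h : G.Edge v w) : G.weight v w + r * x w ≤ G.discountedStep r x v := by
  rw [discountedStep, if_pos hv]
  exact le_ciSup (f := fun w : {w // G.Edge v w} => (G.weight v w : ℝ) + r * x w)
    (Set.finite_range _).bddAbove ⟨w, h⟩

theorem discountedStep_le {r : ℝ} {x : V → ℝ} {v w : V} (hv : v ∉ G.maxVertices)
    (h : G.Edge v w) : G.discountedStep r x v ≤ G.weight v w + r * x w := by
  rw [discountedStep, if_neg hv]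
  exact ciInf_le (f := fun w : {w // G.Edge v w} => (G.weight v w : ℝ) + r * x w)
    (Set.finite_range _).bddBelow ⟨w, h⟩

theorem exists_discountedStep_eq (G : WeightedGraph V) (r : ℝ) (x : V → ℝ) (v : V) :
    ∃ w, G.Edge v w ∧ G.discountedStep r x v = G.weight v w + r * x w := by
  have : Nonempty {w // G.Edge v w} := let ⟨w, hw⟩ := G.deadlockFree v; ⟨⟨w, hw⟩⟩
  by_cases hv : v ∈ G.maxVertices
  · obtain ⟨w, hw⟩ := exists_eq_ciSup_of_finite
      (f := fun w : {w // G.Edge v w} => (G.weight v w : ℝ) + r * x w)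
    exact ⟨w, w.2, by rw [discountedStep, if_pos hv, ← hw]⟩
  · obtain ⟨w, hw⟩ := exists_eq_ciInf_of_finite
      (f := fun w : {w // G.Edge v w} => (G.weight v w : ℝ) + r * x w)
    exact ⟨w, w.2, by rw [discountedStep, if_neg hv, ← hw]⟩

theorem discountedStep_le_add {r : ℝ} (hr : 0 ≤ r) (x y : V → ℝ) (v : V) :
    G.discountedStep r x v ≤ G.discountedStep r y v + r * dist x y := by
  have hxy : ∀ w, r * x w ≤ r * y w + r * dist x y := fun w => by
    have h1 := (Real.dist_eq _ _).symm.le.trans (dist_le_pi_dist x y w)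
    have h2 := mul_le_mul_of_nonneg_left ((le_abs_self _).trans h1) hr
    linarith
  by_cases hv : v ∈ G.maxVertices
  · obtain ⟨w, hw, he⟩ := exists_discountedStep_eq G r x v
    have h1 := le_discountedStep (r := r) (x := y) hv hw
    rw [he]
    linarith [hxy w]
  · obtain ⟨w, hw, he⟩ := exists_discountedStep_eq G r y v
    have h1 := discountedStep_le (r := r) (x := x) hv hw
    rw [he]
    linarith [hxy w]

theorem exists_discountedStep_fixed (G : WeightedGraph V) {r : ℝ} (hr : 0 ≤ r) (hr1 : r < 1) :
    ∃ x : V → ℝ, G.discountedStep r x = x := by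
  have hc : ContractingWith ⟨r, hr⟩ (G.discountedStep r) := by
    refine ⟨hr1, LipschitzWith.of_dist_le_mul fun x y => ?_⟩
    refine (dist_pi_le_iff (by positivity)).2 fun v => ?_
    rw [Real.dist_eq, abs_le]
    have h1 := discountedStep_le_add (G := G) hr x y v
    have h2 := discountedStep_le_add (G := G) hr y x v
    rw [dist_comm] at h2
    show -(r * dist x y) ≤ _ ∧ _ ≤ r * dist x y
    constructor <;> linarith
  exact ⟨_, hc.fixedPoint_isFixedPt⟩

theorem abs_discounted_le {r : ℝ} (hr : 0 ≤ r) (hr1 : r < 1) {x : V → ℝ}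
    (hx : G.discountedStep r x = x) (v : V) : |(1 - r) * x v| ≤ G.maxAbsWeight := by
  have : Nonempty V := ⟨v⟩
  obtain ⟨u, hu⟩ := Finite.exists_max fun v => |x v|
  obtain ⟨w, hw, he⟩ := exists_discountedStep_eq G r x u
  rw [hx] at he
  have h1 : |x u| ≤ |(G.weight u w : ℝ)| + r * |x w| := by
    rw [he]
    refine (abs_add_le _ _).trans ?_
    rw [abs_mul, abs_of_nonneg hr]
  have h2 : |(G.weight u w : ℝ)| ≤ G.maxAbsWeight := by exact_mod_cast G.abs_weight_le hw
  have h3 := mul_le_mul_of_nonneg_left (hu w) hr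
  have h4 := mul_le_mul_of_nonneg_left (hu v) (sub_nonneg.2 hr1.le)
  rw [abs_mul, abs_of_nonneg (sub_nonneg.2 hr1.le)]
  linarith

open Filter Topology in
/-- Along memoryless strategies that are optimal for discount factors tending to `1`, the
normalised values converge to some `y`, here along an ultrafilter, which also makes the strategies
constant. -/
theorem exists_vanishing_discount (G : WeightedGraph V) :
    ∃ (U : Ultrafilter ℕ) (r : ℕ → ℝ) (x : ℕ → V → ℝ) (y : V → ℝ) (f : V → V),
      (∀ v, G.Edge v (f v)) ∧ Tendsto r U (𝓝 1) ∧
      (∀ v, Tendsto (fun m => (1 - r m) * x m v) U (𝓝 (y v))) ∧ (∀ m, r m < 1) ∧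
      (∀ u v, G.Follows G.maxVertices f u v →
        ∀ᶠ m in U, x m u ≤ G.weight u v + r m * x m v) ∧
      (∀ u v, G.Follows G.minVertices f u v →
        ∀ᶠ m in U, G.weight u v + r m * x m v ≤ x m u) := by
  let r : ℕ → ℝ := fun m => 1 - 1 / ((m : ℝ) + 1)
  have hpos : ∀ m : ℕ, (0 : ℝ) < 1 / ((m : ℝ) + 1) := fun m => Nat.one_div_pos_of_nat
  have hr1 : ∀ m, r m < 1 := fun m => by simpa [r] using hpos m
  have hr0 : ∀ m, 0 ≤ r m := fun m => by
    have : 1 / ((m : ℝ) + 1) ≤ 1 := by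
      rw [div_le_one (by positivity)]; linarith [m.cast_nonneg (α := ℝ)]
    simpa [r] using this
  have hU : ((hyperfilter ℕ : Ultrafilter ℕ) : Filter ℕ) ≤ atTop := by
    rw [← Nat.cofinite_eq_atTop]; exact hyperfilter_le_cofinite
  have hrt : Tendsto r (hyperfilter ℕ : Ultrafilter ℕ) (𝓝 1) := by
    refine Tendsto.mono_left ?_ hU
    simpa [r] using tendsto_const_nhds.sub (tendsto_one_div_add_atTop_nhds_zero_nat (𝕜 := ℝ))
  choose x hx using fun m => exists_discountedStep_fixed G (hr0 m) (hr1 m)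
  choose g hg hge using fun m => exists_discountedStep_eq G (r m) (x m)
  have hy : ∀ v, ∃ y, Tendsto (fun m => (1 - r m) * x m v) (hyperfilter ℕ : Ultrafilter ℕ)
      (𝓝 y) := fun v => by
    obtain ⟨y, -, hy⟩ := (isCompact_Icc (a := -(G.maxAbsWeight : ℝ))
      (b := G.maxAbsWeight)).ultrafilter_le_nhds
      ((hyperfilter ℕ).map fun m => (1 - r m) * x m v) (by
        rw [Ultrafilter.coe_map, le_principal_iff, mem_map]
        exact Eventually.of_forall fun m => abs_le.1 (abs_discounted_le (hr0 m) (hr1 m) (hx m) v))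
    exact ⟨y, hy⟩
  choose y hy using hy
  obtain ⟨f, hf⟩ := ((hyperfilter ℕ).map g).eq_pure_of_finite
  have hgf : ∀ᶠ m in (hyperfilter ℕ : Ultrafilter ℕ), g m = f := by
    have : {f} ∈ (hyperfilter ℕ).map g := by rw [hf]; exact Ultrafilter.mem_pure.2 rfl
    exact this
  have hedge : ∀ v, G.Edge v (f v) := by
    obtain ⟨m, hm⟩ := hgf.exists
    exact hm ▸ hg m
  refine ⟨hyperfilter ℕ, r, x, y, f, hedge, hrt, hy, hr1, fun u v huv => ?_, fun u v huv => ?_⟩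
  · filter_upwards [hgf] with m hm
    have he := hge m u
    rw [hx, hm] at he
    by_cases hu : u ∈ G.maxVertices
    · rw [huv.2 hu]
      exact he.le
    · conv_lhs => rw [← hx m]
      exact discountedStep_le hu huv.1
  · filter_upwards [hgf] with m hm
    have he := hge m u
    rw [hx, hm] at he
    by_cases hu : u ∈ G.maxVertices
    · conv_rhs => rw [← hx m]
      exact le_discountedStep hu huv.1
    · rw [huv.2 hu]
      exact he.ge

open Filter Topology in
/-- A consequence of the memoryless determinacy of mean-payoff games: with `A` the set of vertices
of positive mean payoff, Max stays in `A` and makes all cycles there positive, while outside Min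
stays outside and makes all cycles nonpositive. -/
theorem exists_cycle_partition (G : WeightedGraph V) :
    ∃ (A : Set V) (f : V → V), (∀ v, G.Edge v (f v)) ∧
      (∀ u v, G.Follows G.maxVertices f u v → u ∈ A → v ∈ A) ∧
      (∀ u v, G.Follows G.minVertices f u v → u ∉ A → v ∉ A) ∧
      (∀ u l q, u ∈ A → 0 < l → WalkOf (G.Follows G.maxVertices f) G.weight u u l q → 0 < q) ∧
      (∀ u l q, u ∉ A → WalkOf (G.Follows G.minVertices f) G.weight u u l q → q ≤ 0) := by
  obtain ⟨U, r, x, y, f, hf, hr, hy, hr1, hmax, hmin⟩ := exists_vanishing_discount G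
  have hlim : ∀ u v, Tendsto (fun m => (1 - r m) * G.weight u v + r m * ((1 - r m) * x m v)) U
      (𝓝 (y v)) := fun u v => by
    have h1 := ((tendsto_const_nhds (x := (1 : ℝ))).sub hr).mul_const (G.weight u v : ℝ)
    simpa using h1.add (hr.mul (hy v))
  have hmono : ∀ u v, G.Follows G.maxVertices f u v → y u ≤ y v := fun u v huv => by
    refine le_of_tendsto_of_tendsto (hy u) (hlim u v) ?_
    filter_upwards [hmax u v huv] with m hm
    have := mul_le_mul_of_nonneg_left hm (sub_nonneg.2 (hr1 m).le)
    linarith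
  have hanti : ∀ u v, G.Follows G.minVertices f u v → y v ≤ y u := fun u v huv => by
    refine le_of_tendsto_of_tendsto (hlim u v) (hy u) ?_
    filter_upwards [hmin u v huv] with m hm
    have := mul_le_mul_of_nonneg_left hm (sub_nonneg.2 (hr1 m).le)
    linarith
  have hwmax : ∀ (ε : ℝ), 0 < ε → ∀ u v l q, WalkOf (G.Follows G.maxVertices f) G.weight u v l q →
      y u ≤ y v ∧ ∀ᶠ m in U, x m u + l * (y u - ε) ≤ q + x m v := by
    intro ε hε u v l q h
    induction h with
    | nil => exact ⟨le_rfl, by simp⟩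
    | @snoc b c l p _ hbc ih =>
      refine ⟨ih.1.trans (hmono _ _ hbc), ?_⟩
      have hc := (hy c).eventually (lt_mem_nhds (sub_lt_self (y c) hε))
      filter_upwards [ih.2, hmax _ _ hbc, hc] with m h1 h2 h3
      have h4 := ih.1.trans (hmono _ _ hbc)
      push_cast
      linarith
  have hwmin : ∀ (ε : ℝ), 0 < ε → ∀ u v l q, WalkOf (G.Follows G.minVertices f) G.weight u v l q →
      y v ≤ y u ∧ ∀ᶠ m in U, q + x m v ≤ x m u + l * (y u + ε) := by
    intro ε hε u v l q h
    induction h with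
    | nil => exact ⟨le_rfl, by simp⟩
    | @snoc b c l p _ hbc ih =>
      refine ⟨(hanti _ _ hbc).trans ih.1, ?_⟩
      have hc := (hy c).eventually (gt_mem_nhds (lt_add_of_pos_right (y c) hε))
      filter_upwards [ih.2, hmin _ _ hbc, hc] with m h1 h2 h3
      have h4 := (hanti _ _ hbc).trans ih.1
      push_cast
      linarith
  refine ⟨{v | 0 < y v}, f, hf, fun u v huv hu => lt_of_lt_of_le hu (hmono u v huv),
    fun u v huv hu hv => hu (lt_of_lt_of_le hv (hanti u v huv)), fun u l q hu hl h => ?_,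
    fun u l q hu h => ?_⟩
  · have hu' : 0 < y u := hu
    obtain ⟨m, hm⟩ := (hwmax (y u / 2) (half_pos hu') u u l q h).2.exists
    have h1 : (0 : ℝ) < l * (y u - y u / 2) :=
      mul_pos (by exact_mod_cast hl) (by linarith)
    have h2 : (0 : ℝ) < q := by linarith
    exact_mod_cast h2
  · have hu' : y u ≤ 0 := not_lt.1 hu
    have hε : (0 : ℝ) < 1 / ((l : ℝ) + 1) := Nat.one_div_pos_of_nat
    obtain ⟨m, hm⟩ := (hwmin _ hε u u l q h).2.exists
    have h1 : (l : ℝ) * (y u + 1 / ((l : ℝ) + 1)) ≤ l * (1 / ((l : ℝ) + 1)) :=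
      mul_le_mul_of_nonneg_left (by linarith) l.cast_nonneg
    have h2 : (l : ℝ) * (1 / ((l : ℝ) + 1)) < 1 := by
      rw [mul_one_div, div_lt_one (by positivity)]; linarith
    have h3 : (q : ℝ) < (1 : ℤ) := by push_cast; linarith
    have := Int.cast_lt.1 h3
    omega

end MeanPayoff

/-! ### Positional certificates for Max -/

section Certificate

variable {V : Type*} (G : WeightedGraph V)

/-- An upper bound for the absolute value of the weight of a simple path. -/
noncomputable abbrev pathBound [Fintype V] : ℕ := (Fintype.card V - 1) * G.maxAbsWeight

/-- `Y` is a potential for the moves that are possible when Max plays according to `f`, and cycles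
are nonnegative where `Y` is not `⊥` and positive where `Y` is positive. -/
structure IsCertificate (f : V → V) (Y : V → EReal) : Prop where
  edge (v : V) : G.Edge v (f v)
  le_intShift {u v : V} : G.Follows G.maxVertices f u v → Y u ≤ intShift (G.weight u v) (Y v)
  nonneg {u : V} {l : ℕ} {q : ℤ} :
    WalkOf (G.Follows G.maxVertices f) G.weight u u l q → Y u ≠ ⊥ → 0 ≤ q
  pos {u : V} {l : ℕ} {q : ℤ} :
    WalkOf (G.Follows G.maxVertices f) G.weight u u (l + 1) q → 0 < Y u → 0 < q

namespace IsCertificate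

variable {G} {f : V → V} {Y : V → EReal}

theorem le_intShift_of_walkOf (hY : G.IsCertificate f Y) {u v : V} {l : ℕ} {p : ℤ}
    (h : WalkOf (G.Follows G.maxVertices f) G.weight u v l p) : Y u ≤ intShift p (Y v) := by
  induction h with
  | nil => rw [intShift_zero]
  | snoc _ hbc ih =>
    rw [← intShift_intShift]
    exact ih.trans ((intShift _).monotone (hY.le_intShift hbc))

theorem ne_bot_of_walkOf (hY : G.IsCertificate f Y) {u v : V} {l : ℕ} {p : ℤ} (hu : Y u ≠ ⊥)
    (h : WalkOf (G.Follows G.maxVertices f) G.weight u v l p) : Y v ≠ ⊥ := by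
  intro hv
  have := hY.le_intShift_of_walkOf h
  rw [hv, map_bot, le_bot_iff] at this
  exact hu this

theorem neg_pathBound_le [Fintype V] (hY : G.IsCertificate f Y) {u v : V} {l : ℕ} {p : ℤ}
    (hu : Y u ≠ ⊥)
    (h : WalkOf (G.Follows G.maxVertices f) G.weight u v l p) : -(G.pathBound : ℤ) ≤ p :=
  h.neg_mul_le (P := fun v => Y v ≠ ⊥)
    (fun _ _ huv hu => hY.ne_bot_of_walkOf hu (WalkOf.nil.snoc huv))
    (fun _ _ _ hu hq => hY.nonneg hq hu)
    (fun _ _ huv => (abs_le.1 (G.abs_weight_le huv.1)).1) hu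

/-- Once the payoff is below `c ≤ Y v`, no vertex `u` can be visited twice with the same payoff:
the potential is positive at `u`, whereas the cycle in between would have weight `0`. -/
theorem not_closed_of_lt (hY : G.IsCertificate f Y) {v u : V} {l k : ℕ} {p c : ℤ}
    (hc : ((c : ℝ) : EReal) ≤ Y v) (hp : p < c)
    (h : WalkOf (G.Follows G.maxVertices f) G.weight v u l p) :
    ¬ WalkOf (G.Follows G.maxVertices f) G.weight u u (k + 1) 0 := by
  intro h0
  refine lt_irrefl 0 (hY.pos h0 ?_)
  have h1 := hc.trans (hY.le_intShift_of_walkOf h)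
  rw [le_intShift_iff, intShift_coe] at h1
  refine lt_of_lt_of_le ?_ h1
  have : (((0 : ℤ) : ℝ) : EReal) < (((-p + c : ℤ) : ℝ) : EReal) := coe_int_lt.2 (by omega)
  simpa using this

theorem ne_bot_of_coe_le {c : ℤ} {x : EReal} (hc : ((c : ℝ) : EReal) ≤ x) : x ≠ ⊥ := by
  rintro rfl
  exact EReal.coe_ne_bot _ (le_bot_iff.1 hc)

/-- The memoryless strategy of a certificate guarantees the potential: a payoff below `c ≤ Y v`
occurs at most once at each vertex, hence only finitely often. -/
theorem le_lowerValue_totalPayoff [Fintype V] (hY : G.IsCertificate f Y) {v : V} {c : ℤ}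
    (hc : ((c : ℝ) : EReal) ≤ Y v) : ((c : ℝ) : EReal) ≤ G.lowerValue G.totalPayoff v := by
  refine le_iSup_of_le (memoryless f hY.edge) (le_iInf fun τ => ?_)
  set π := outcome v (memoryless f hY.edge) τ with hπ
  have hstep : ∀ i, G.Follows G.maxVertices f (π i) (π (i + 1)) := fun i =>
    ⟨edge_outcome _ _ _ _, outcome_memoryless hY.edge v τ⟩
  have hwalk : ∀ i k, WalkOf (G.Follows G.maxVertices f) G.weight (π i) (π (i + k)) k
      (G.prefixPayoff π (i + k) - G.prefixPayoff π i) := by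
    intro i k
    induction k with
    | zero => exact WalkOf.nil.cast (sub_self _).symm
    | succ k ih =>
      exact (ih.snoc (hstep (i + k))).cast (by rw [← add_assoc, prefixPayoff_succ]; ring)
  have hwalk0 : ∀ i, WalkOf (G.Follows G.maxVertices f) G.weight v (π i) i
      (G.prefixPayoff π i) := fun i => by
    have h := hwalk 0 i
    rw [zero_add] at h
    exact h.cast (sub_zero _)
  have hfin : {i | G.prefixPayoff π i < c}.Finite := by
    refine Set.Finite.of_injOn (f := fun i => (π i, G.prefixPayoff π i))
      (t := Set.univ ×ˢ Set.Icc (-(G.pathBound : ℤ)) c) (fun i hi => ?_) (fun i hi j hj hij => ?_)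
      (Set.finite_univ.prod (Set.finite_Icc _ _))
    · exact ⟨trivial, hY.neg_pathBound_le (ne_bot_of_coe_le hc) (hwalk0 i), le_of_lt hi⟩
    · have key : ∀ i j, i < j → G.prefixPayoff π i < c → π i = π j →
          G.prefixPayoff π i = G.prefixPayoff π j → False := by
        intro i j hlt hi h1 h2
        obtain ⟨k, rfl⟩ : ∃ k, j = i + (k + 1) := ⟨j - i - 1, by omega⟩
        have h := hwalk i (k + 1)
        rw [← h1, ← h2, sub_self] at h
        exact hY.not_closed_of_lt hc hi (hwalk0 i) h
      obtain ⟨h1, h2⟩ := Prod.mk.inj hij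
      rcases lt_trichotomy i j with h | h | h
      · exact (key i j h hi h1 h2).elim
      · exact h
      · exact (key j i h hj h1.symm h2.symm).elim
  refine Filter.le_liminf_of_le (by isBoundedDefault) ?_
  have hev := hfin.eventually_cofinite_notMem
  rw [Nat.cofinite_eq_atTop] at hev
  filter_upwards [hev] with i hi
  exact coe_int_le.2 (not_lt.1 hi)

/-- In the layered game, Max follows a certificate and vetoes as long as the payoff is below
`c ≤ Y v`. The pairs of a vertex and a payoff at which a veto occurs are distinct, and distinct
from the initial pair; so the number of layers needed is at most the number of those pairs. -/
theorem le_layerValue [Fintype V] (hY : G.IsCertificate f Y) {v : V} {c : ℤ} {C k : ℕ}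
    (hc : ((c : ℝ) : EReal) ≤ Y v) (hcC : c ≤ C) (hC : 1 ≤ C)
    (hk : Fintype.card V * (G.pathBound + C) ≤ k) : ((c : ℝ) : EReal) ≤ G.layerValue k v := by
  classical
  let R := G.Follows G.maxVertices f
  -- `Vetoed S u p`: some walk to `u` of weight `p` passes through all the pairs of `S`.
  let Vetoed : Finset (V × ℤ) → V → ℤ → Prop := fun S u p =>
    (∃ l, WalkOf R G.weight v u l p) ∧ (v, 0) ∉ S ∧ ∀ e ∈ S, e.2 < c ∧
      (∃ l, WalkOf R G.weight v e.1 l e.2) ∧ ∃ l, WalkOf R G.weight e.1 u l (p - e.2)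
  have hne : Y v ≠ ⊥ := ne_bot_of_coe_le hc
  have hcard : ∀ S u p, Vetoed S u p → S.card < Fintype.card V * (G.pathBound + C) := by
    rintro S u p ⟨-, hvS, hS⟩
    have hsub : insert (v, 0) S ⊆ Finset.univ ×ˢ Finset.Ico (-(G.pathBound : ℤ)) C := by
      intro e he
      rw [Finset.mem_product]
      refine ⟨Finset.mem_univ _, ?_⟩
      rw [Finset.mem_Ico]
      rcases Finset.mem_insert.1 he with rfl | he
      · constructor <;> dsimp only <;> omega
      · obtain ⟨h1, ⟨l, h2⟩, -⟩ := hS e he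
        exact ⟨hY.neg_pathBound_le hne h2, by omega⟩
    have h := Finset.card_le_card hsub
    rw [Finset.card_insert_of_notMem hvS, Finset.card_product, Finset.card_univ, Int.card_Ico,
      show ((C : ℤ) - -(G.pathBound : ℤ)).toNat = G.pathBound + C by omega] at h
    exact h
  have main : ∀ j S u p, Vetoed S u p → Fintype.card V * (G.pathBound + C) ≤ S.card + j →
      (((c - p : ℤ) : ℝ) : EReal) ≤ G.layerValue j u := by
    intro j
    induction j with
    | zero =>
      intro S u p h hle
      exact absurd (hcard S u p h) (not_lt.2 hle)
    | succ j ih =>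
      -- The best bound that the claim asserts at `u` is a post-fixed point of the stopping game.
      let g : V → EReal := fun u => ⨆ (p : ℤ) (_ : ∃ S, Vetoed S u p ∧
        Fintype.card V * (G.pathBound + C) ≤ S.card + (j + 1)), (((c - p : ℤ) : ℝ) : EReal)
      have hle_g : ∀ S u p, Vetoed S u p →
          Fintype.card V * (G.pathBound + C) ≤ S.card + (j + 1) →
          (((c - p : ℤ) : ℝ) : EReal) ≤ g u := fun S u p h h' =>
        le_iSup₂_of_le p ⟨S, h, h'⟩ le_rfl
      suffices hg : g ≤ G.layerValue (j + 1) from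
        fun S u p h h' => (hle_g S u p h h').trans (hg u)
      refine le_stopValue fun u => iSup₂_le ?_
      rintro p ⟨S, hS, hSj⟩
      obtain ⟨⟨l, hl⟩, hvS, hmem⟩ := hS
      have hnext : ∀ w, R u w →
          (((c - p : ℤ) : ℝ) : EReal) ≤ intShift (G.weight u w) ((g ⊓ G.stopCost j) w) := by
        intro w huw
        have hS' : Vetoed S w (p + G.weight u w) := by
          refine ⟨⟨_, hl.snoc huw⟩, hvS, fun e he => ?_⟩
          obtain ⟨h1, h2, k, h3⟩ := hmem e he
          exact ⟨h1, h2, _, (h3.snoc huw).cast (by ring)⟩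
        rw [le_intShift_iff, intShift_coe,
          show -G.weight u w + (c - p) = c - (p + G.weight u w) by ring]
        refine le_inf (hle_g S w _ hS' hSj) ?_
        -- Max vetoes a request to stop exactly if the payoff is below `c`.
        by_cases hlt : p + G.weight u w < c
        · refine le_sup_of_le_right (ih (insert (w, p + G.weight u w) S) w _ ?_ ?_)
          · refine ⟨hS'.1, ?_, ?_⟩
            · rw [Finset.mem_insert, not_or]
              refine ⟨fun h => ?_, hvS⟩
              obtain ⟨rfl, h2⟩ := Prod.mk.inj h
              refine hY.not_closed_of_lt hc (h2 ▸ hlt) WalkOf.nil ((hl.snoc huw).cast h2.symm)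
            · intro e he
              rcases Finset.mem_insert.1 he with rfl | he
              · exact ⟨hlt, hS'.1, 0, WalkOf.nil.cast (sub_self _).symm⟩
              · exact hS'.2.2 e he
          · rw [Finset.card_insert_of_notMem]
            · omega
            · intro he
              obtain ⟨h1, ⟨m, h2⟩, k, h3⟩ := hmem _ he
              exact hY.not_closed_of_lt hc hlt h2 ((h3.snoc huw).cast (by ring))
        · refine le_sup_of_le_left ?_
          have : (((c - (p + G.weight u w) : ℤ) : ℝ) : EReal) ≤ (((0 : ℤ) : ℝ) : EReal) :=
            coe_int_le.2 (by omega)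
          simpa using this
      by_cases hu : u ∈ G.maxVertices
      · exact (hnext _ ⟨hY.edge u, fun _ => rfl⟩).trans (le_bellman_of_mem hu (hY.edge u))
      · exact le_bellman fun w hw => hnext w ⟨hw, fun h => absurd h hu⟩
  have := main k ∅ v 0 ⟨⟨0, .nil⟩, by simp, by simp⟩ (by simpa using hk)
  simpa using this

end IsCertificate

end Certificate

/-! ### A bound for the values from nonpositive cycles -/

section CycleBound

variable {V : Type*} (G : WeightedGraph V)

/-- The supremum of the weights of the nonempty walks from `v` when Min plays according to `f`. -/
noncomputable def walkSup (f : V → V) (v : V) : EReal :=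
  ⨆ (p : ℤ) (_ : ∃ u l, WalkOf (G.Follows G.minVertices f) G.weight v u (l + 1) p),
    ((p : ℝ) : EReal)

variable {G} {f : V → V}

theorem intShift_max_walkSup_le {v w : V} (h : G.Follows G.minVertices f v w) :
    intShift (G.weight v w) (max 0 (G.walkSup f w)) ≤ G.walkSup f v := by
  rw [intShift_le_iff]
  refine max_le ?_ (iSup₂_le ?_)
  · rw [le_intShift_iff, neg_neg]
    refine le_iSup₂_of_le (G.weight v w) ⟨w, 0, (WalkOf.nil.snoc h).cast (zero_add _)⟩ ?_
    simp [intShift_apply]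
  · rintro p ⟨u, l, hp⟩
    rw [le_intShift_iff, neg_neg, intShift_coe]
    exact le_iSup₂_of_le (G.weight v w + p) ⟨u, l + 1, hp.cons h⟩ le_rfl

/-- In every layer Min may follow `f` and ask to stop after the first move. -/
theorem layerValue_le_walkSup [Finite V] (hf : ∀ v, G.Edge v (f v)) (j : ℕ) :
    G.layerValue j ≤ G.walkSup f := by
  induction j with
  | zero => exact bot_le
  | succ j ih =>
    intro v
    rw [layerValue_succ_eq]
    have key : ∀ w, G.Follows G.minVertices f v w →
        intShift (G.weight v w) ((G.layerValue (j + 1) ⊓ G.stopCost j) w) ≤ G.walkSup f v :=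
      fun w h => le_trans ((intShift _).monotone
        (inf_le_right.trans (sup_le_sup le_rfl (ih w)))) (intShift_max_walkSup_le h)
    by_cases hv : v ∈ G.maxVertices
    · obtain ⟨w, hw, he⟩ := exists_bellman_eq G (G.layerValue (j + 1) ⊓ G.stopCost j) v
      rw [he]
      exact key w ⟨hw, fun h => absurd hv h⟩
    · exact (bellman_le_of_notMem hv (hf v)).trans (key _ ⟨hf v, fun _ => rfl⟩)

theorem walkSup_le [Fintype V] {A : Set V}
    (hA : ∀ u v, G.Follows G.minVertices f u v → u ∉ A → v ∉ A)
    (hcyc : ∀ u l q, u ∉ A → WalkOf (G.Follows G.minVertices f) G.weight u u l q → q ≤ 0)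
    {v : V} (hv : v ∉ A) : G.walkSup f v ≤ (((G.pathBound : ℤ) : ℝ) : EReal) := by
  refine iSup₂_le ?_
  rintro p ⟨u, l, hp⟩
  rw [coe_int_le]
  have := hp.neg.neg_mul_le (W := G.maxAbsWeight) (P := fun v => v ∉ A) hA
    (fun u k q hu hq => by
      have := hcyc u k (-q) hu (by simpa using hq.neg)
      omega)
    (fun u v huv => by
      have := (abs_le.1 (G.abs_weight_le huv.1)).2
      omega) hv
  have h2 : (((Fintype.card V - 1) * G.maxAbsWeight : ℕ) : ℤ) = (G.pathBound : ℤ) := rfl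
  omega

end CycleBound

/-! ### The certificate given by the values of the layers -/

section LimitValue

variable {V : Type*} (G : WeightedGraph V)

open Classical in
/-- The limit of the values of the layers, corrected to `⊤` on the set `A`. -/
noncomputable def limitValue (A : Set V) (v : V) : EReal :=
  if v ∈ A then ⊤ else ⨆ j, G.layerValue j v

variable {G} {A : Set V}

theorem limitValue_of_mem {v : V} (hv : v ∈ A) : G.limitValue A v = ⊤ := if_pos hv

theorem layerValue_le_limitValue (A : Set V) (j : ℕ) (v : V) :
    G.layerValue j v ≤ G.limitValue A v := by
  unfold limitValue
  split_ifs
  · exact le_top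
  · exact le_iSup (fun j => G.layerValue j v) j

theorem isExtInt_limitValue (v : V) : IsExtInt (G.limitValue A v) := by
  unfold limitValue
  split_ifs
  · exact .top
  · exact .iSup fun j => isExtInt_layerValue j v

theorem limitValue_le {v : V} (hv : v ∉ A) {b : EReal} (h : ∀ j, G.layerValue j v ≤ b) :
    G.limitValue A v ≤ b := by
  rw [limitValue, if_neg hv]
  exact iSup_le h

theorem exists_layerValue_eq {v : V} (hv : v ∉ A) (ht : G.limitValue A v ≠ ⊤) :
    ∃ j, G.layerValue j v = G.limitValue A v := by
  by_cases hb : G.limitValue A v = ⊥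
  · exact ⟨0, hb.symm ▸ rfl⟩
  · obtain ⟨c, hc⟩ := (isExtInt_limitValue v).eq_coe hb ht
    have hlt : (((c - 1 : ℤ) : ℝ) : EReal) < ⨆ j, G.layerValue j v := by
      have : G.limitValue A v = ⨆ j, G.layerValue j v := if_neg hv
      rw [← this, hc, coe_int_lt]
      omega
    obtain ⟨j, hj⟩ := lt_iSup_iff.1 hlt
    refine ⟨j, le_antisymm (layerValue_le_limitValue A j v) ?_⟩
    rw [hc]
    have := (isExtInt_layerValue j v (c - 1)).resolve_left hj.not_ge
    rwa [sub_add_cancel] at this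

/-- Max plays in `A` as `f` prescribes, and elsewhere optimally in the first layer whose value is
the limit value. As long as no potential is gained this layer does not increase along the play, and
while it stays the same, the potential is nonpositive. -/
theorem exists_isCertificate [Fintype V] {f : V → V} (hf : ∀ v, G.Edge v (f v))
    (hA : ∀ u v, G.Follows G.maxVertices f u v → u ∈ A → v ∈ A)
    (hcyc : ∀ u l q, u ∈ A → 0 < l → WalkOf (G.Follows G.maxVertices f) G.weight u u l q → 0 < q)
    (ht : ∀ v, v ∉ A → G.limitValue A v ≠ ⊤) :
    ∃ g, G.IsCertificate g (G.limitValue A) := by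
  classical
  have hex : ∀ v, ∃ j, v ∉ A → G.layerValue j v = G.limitValue A v := fun v => by
    by_cases hv : v ∈ A
    · exact ⟨0, fun h => absurd hv h⟩
    · obtain ⟨j, hj⟩ := exists_layerValue_eq hv (ht v hv)
      exact ⟨j, fun _ => hj⟩
  let rank : V → ℕ := fun v => Nat.find (hex v)
  have hrank : ∀ v, v ∉ A → G.layerValue (rank v) v = G.limitValue A v :=
    fun v => Nat.find_spec (hex v)
  have hrank_le : ∀ v j, G.layerValue j v = G.limitValue A v → rank v ≤ j :=
    fun v j h => Nat.find_min' (hex v) fun _ => h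
  choose s hs hse using fun j => exists_bellman_eq G (G.layerValue j ⊓ G.stopCost (j - 1))
  let g : V → V := fun v => if v ∈ A then f v else s (rank v) v
  have hgA : ∀ u v, G.Follows G.maxVertices g u v → u ∈ A → G.Follows G.maxVertices f u v :=
    fun u v huv hu => ⟨huv.1, fun hm => (huv.2 hm).trans (if_pos hu)⟩
  have hgA' : ∀ u v, G.Follows G.maxVertices g u v → u ∈ A → v ∈ A :=
    fun u v huv hu => hA u v (hgA u v huv hu) hu
  have hedge : ∀ u v, G.Follows G.maxVertices g u v → u ∉ A → G.limitValue A u ≠ ⊥ →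
      ∃ j, rank u = j + 1 ∧ G.limitValue A u ≤
        intShift (G.weight u v) (min (G.layerValue (j + 1) v) (G.stopCost j v)) := by
    intro u v huv hu hb
    have h0 := hrank u hu
    obtain ⟨j, hj⟩ : ∃ j, rank u = j + 1 := by
      cases hr : rank u with
      | zero => rw [hr] at h0; exact absurd h0.symm hb
      | succ j => exact ⟨j, rfl⟩
    refine ⟨j, hj, ?_⟩
    rw [← h0, hj]
    refine (congrFun (layerValue_succ_eq j) u).le.trans ?_
    by_cases hm : u ∈ G.maxVertices
    · have h1 : v = s (j + 1) u := by rw [huv.2 hm]; simp only [g, if_neg hu, hj]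
      rw [h1]
      exact (hse (j + 1) u).le
    · exact bellman_le_of_notMem hm huv.1
  have hpot : ∀ u v, G.Follows G.maxVertices g u v →
      G.limitValue A u ≤ intShift (G.weight u v) (G.limitValue A v) := by
    intro u v huv
    by_cases hu : u ∈ A
    · rw [limitValue_of_mem (hgA' u v huv hu), map_top]
      exact le_top
    · by_cases hb : G.limitValue A u = ⊥
      · rw [hb]; exact bot_le
      · obtain ⟨j, -, h⟩ := hedge u v huv hu hb
        exact h.trans ((intShift _).monotone
          ((min_le_left _ _).trans (layerValue_le_limitValue A _ v)))
  have hwalk : ∀ u v l p, WalkOf (G.Follows G.maxVertices g) G.weight u v l p →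
      G.limitValue A u ≠ ⊥ → v ∈ A ∨ G.limitValue A u ≤ intShift p (G.limitValue A v) ∧
        (G.limitValue A u = intShift p (G.limitValue A v) →
          rank v ≤ rank u ∧ (0 < l → rank v = rank u → G.limitValue A v ≤ 0)) := by
    intro u v l p h hu
    induction h with
    | nil => exact .inr ⟨by rw [intShift_zero], fun _ => ⟨le_rfl, fun h => absurd h (lt_irrefl _)⟩⟩
    | @snoc b c l p _ hbc ih =>
      rcases ih with hb | ⟨hle, heq⟩
      · exact .inl (hgA' b c hbc hb)
      by_cases hb : b ∈ A
      · exact .inl (hgA' b c hbc hb)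
      by_cases hc : c ∈ A
      · exact .inl hc
      have hb' : G.limitValue A b ≠ ⊥ := by
        intro hb'
        rw [hb', map_bot, le_bot_iff] at hle
        exact hu hle
      obtain ⟨j, hj, hedge⟩ := hedge b c hbc hb hb'
      refine .inr ⟨?_, fun he => ?_⟩
      · rw [← intShift_intShift]
        exact hle.trans ((intShift _).monotone (hpot b c hbc))
      · rw [← intShift_intShift] at he
        obtain ⟨hr, -⟩ := heq (le_antisymm hle
          (((intShift p).monotone (hpot b c hbc)).trans he.ge))
        have h1 : G.limitValue A c ≤ min (G.layerValue (j + 1) c) (G.stopCost j c) := by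
          rw [← (intShift (G.weight b c)).le_iff_le, ← (intShift p).le_iff_le, ← he]
          exact hle.trans ((intShift p).monotone hedge)
        have h2 : rank c ≤ j + 1 := hrank_le c _
          (le_antisymm (layerValue_le_limitValue A _ c) (h1.trans (min_le_left _ _)))
        refine ⟨by omega, fun _ hcu => ?_⟩
        have h3 := h1.trans (min_le_right _ _)
        rcases le_sup_iff.1 h3 with h3 | h3
        · exact h3
        · have := hrank_le c j (le_antisymm (layerValue_le_limitValue A _ c) h3)
          omega
  have hnonneg : ∀ u l q, WalkOf (G.Follows G.maxVertices g) G.weight u u l q →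
      G.limitValue A u ≠ ⊥ → 0 ≤ q ∧ (0 < l → 0 < G.limitValue A u → 0 < q) := by
    intro u l q h hb
    by_cases hu : u ∈ A
    · have h1 : WalkOf (G.Follows G.maxVertices f) G.weight u u l q :=
        (h.restrict hgA' hu).1.mono fun a b hab => hgA a b hab.1 hab.2.1
      rcases Nat.eq_zero_or_pos l with rfl | hl
      · cases h
        exact ⟨le_rfl, fun h => absurd h (lt_irrefl _)⟩
      · have := hcyc u l q hu hl h1
        exact ⟨this.le, fun _ _ => this⟩
    · obtain ⟨hle, heq⟩ := (hwalk u u l q h hb).resolve_left hu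
      obtain ⟨c, hc⟩ := (isExtInt_limitValue u).eq_coe hb (ht u hu)
      rw [hc, intShift_coe, coe_int_le] at hle
      refine ⟨by omega, fun hl hpos => ?_⟩
      by_contra hq
      obtain rfl : q = 0 := by omega
      exact ((heq (intShift_zero _).symm).2 hl rfl).not_gt hpos
  refine ⟨g, fun v => ?_, fun {u v} => hpot u v, fun {u l q} h hb => (hnonneg u l q h hb).1,
    fun {u l q} h hp => (hnonneg u _ q h hp.ne_bot).2 (Nat.succ_pos _) hp⟩
  by_cases hv : v ∈ A
  · simp only [g, if_pos hv]; exact hf v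
  · simp only [g, if_neg hv]; exact hs _ _

end LimitValue

/-! ### What Min guarantees -/

section UpperBound

variable {V : Type*} [Fintype V] {G : WeightedGraph V} {A : Set V} {f : V → V}

/-- Outside `A` Min plays the stopping game of a layer `J + 1` so high that the values of the
layers are stable outside `A` and large on `A`, and starts afresh whenever it pays to stop. The
budget, which is `c` minus the payoff so far, is then nonnegative infinitely often. A play can
enter `A` only with a large budget; but Min abandons the stopping game in favour of `f` as soon as the budget exceeds all the
weights of the walks that `f` allows. -/
theorem upperValue_totalPayoff_le (hf : ∀ v, G.Edge v (f v))
    (hA : ∀ u v, G.Follows G.minVertices f u v → u ∉ A → v ∉ A)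
    (hsup : ∀ v, v ∉ A → G.walkSup f v ≤ (((G.pathBound : ℤ) : ℝ) : EReal)) (J : ℕ)
    (hJ : ∀ v, v ∉ A → G.layerValue J v = G.layerValue (J + 1) v)
    (hJA : ∀ v ∈ A, (((G.pathBound + G.maxAbsWeight + 1 : ℤ) : ℝ) : EReal) ≤ G.layerValue J v)
    {v : V} (hv : v ∉ A) {c : ℤ} (hc : G.layerValue J v ≤ ((c : ℝ) : EReal)) :
    G.upperValue G.totalPayoff v ≤ ((c : ℝ) : EReal) := by
  classical
  -- `X n` is the value of the stopping game that lasts at most `n` rounds.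
  let X : ℕ → V → EReal := fun n => (G.stopStep (G.stopCost J))^[n] ⊤
  have hX : ∀ n, G.layerValue (J + 1) ≤ X n := fun n => iInf_le _ n
  have hXsucc : ∀ n, X (n + 1) = G.bellman (X n ⊓ G.stopCost J) :=
    fun n => Function.iterate_succ_apply' _ _ _
  have hN : ∀ (w : V) (b : ℤ), ∃ n, w ∉ A → G.layerValue J w ≤ ((b : ℝ) : EReal) →
      X n w ≤ ((b : ℝ) : EReal) := by
    intro w b
    by_cases h : w ∉ A ∧ G.layerValue J w ≤ ((b : ℝ) : EReal)
    · obtain ⟨n, hn⟩ := exists_le_of_iInf_le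
        (fun n => isExtInt_iterate_stopStep (G := G) (isExtInt_stopCost J) n w)
        (((stopValue_apply _ w).symm.trans (hJ w h.1).symm).le.trans h.2)
      exact ⟨n, fun _ _ => hn⟩
    · exact ⟨0, fun h1 h2 => absurd ⟨h1, h2⟩ h⟩
  choose N hN using hN
  choose s hs hse using fun n => exists_bellman_eq G (X n ⊓ G.stopCost J)
  -- The memory is the number of rounds left in the current stopping game, and the budget.
  let upd : ℕ × ℤ → V → V → ℕ × ℤ := fun m u w =>
    (if G.stopCost J w ≤ (((m.2 - G.weight u w : ℤ) : ℝ) : EReal) then N w (m.2 - G.weight u w)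
      else m.1 - 1, m.2 - G.weight u w)
  let move : ℕ × ℤ → V → V := fun m u =>
    if G.walkSup f u ≤ ((m.2 : ℝ) : EReal) then f u else s (m.1 - 1) u
  have hmove : ∀ m u, G.Edge u (move m u) := fun m u => by
    simp only [move]
    split_ifs
    · exact hf u
    · exact hs _ u
  let Inv : ℕ × ℤ → V → Prop := fun m u => u ∉ A ∧
    (G.walkSup f u ≤ ((m.2 : ℝ) : EReal) ∨ X m.1 u ≤ ((m.2 : ℝ) : EReal))
  have hzero : ∀ b : ℤ, (0 : EReal) ≤ ((b : ℝ) : EReal) → 0 ≤ b := fun b hb => by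
    have : (((0 : ℤ) : ℝ) : EReal) ≤ ((b : ℝ) : EReal) := by simpa using hb
    exact coe_int_le.1 this
  have hstep : ∀ m u w, Inv m u → G.Edge u w → (u ∉ G.maxVertices → w = move m u) →
      Inv (upd m u w) w ∧ (0 ≤ (upd m u w).2 ∨
        ¬ G.walkSup f u ≤ ((m.2 : ℝ) : EReal) ∧ (upd m u w).1 < m.1) := by
    rintro ⟨n, b⟩ u w ⟨hu, hInv⟩ huw hw
    by_cases hD : G.walkSup f u ≤ ((b : ℝ) : EReal)
    · have hfol : G.Follows G.minVertices f u w :=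
        ⟨huw, fun hm => (hw hm).trans (if_pos hD)⟩
      have h1 := (intShift_max_walkSup_le hfol).trans hD
      rw [intShift_le_iff, intShift_coe, neg_add_eq_sub] at h1
      exact ⟨⟨hA u w hfol hu, .inl ((le_max_right _ _).trans h1)⟩,
        .inl (hzero _ ((le_max_left _ _).trans h1))⟩
    · have hXn : X n u ≤ ((b : ℝ) : EReal) := hInv.resolve_left hD
      have hb : b < G.pathBound := by
        by_contra hb
        exact hD ((hsup u hu).trans (coe_int_le.2 (not_lt.1 hb)))
      obtain ⟨n, rfl⟩ : ∃ k, n = k + 1 := by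
        cases n with
        | zero => exact absurd (top_le_iff.1 hXn) (EReal.coe_ne_top _)
        | succ k => exact ⟨k, rfl⟩
      have h1 : intShift (G.weight u w) ((X n ⊓ G.stopCost J) w) ≤ ((b : ℝ) : EReal) := by
        refine le_trans ?_ hXn
        rw [hXsucc]
        by_cases hm : u ∈ G.maxVertices
        · exact le_bellman_of_mem hm huw
        · have : w = s n u := (hw hm).trans (if_neg hD)
          rw [this]
          exact (hse n u).ge
      rw [intShift_le_iff, intShift_coe, neg_add_eq_sub, Pi.inf_apply] at h1
      have hwA : w ∉ A := by
        intro hwA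
        have h2 : (((G.pathBound + G.maxAbsWeight + 1 : ℤ) : ℝ) : EReal) ≤
            (((b - G.weight u w : ℤ) : ℝ) : EReal) := by
          refine le_trans (le_min ?_ ?_) h1
          · exact (hJA w hwA).trans ((layerValue_mono (Nat.le_succ J) w).trans (hX n w))
          · exact (hJA w hwA).trans le_sup_right
        have h3 := coe_int_le.1 h2
        have h4 := (abs_le.1 (G.abs_weight_le huw)).1
        omega
      by_cases hE : G.stopCost J w ≤ (((b - G.weight u w : ℤ) : ℝ) : EReal)
      · refine ⟨⟨hwA, .inr ?_⟩, .inl (hzero _ (le_sup_left.trans hE))⟩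
        simp only [upd, if_pos hE]
        exact hN w _ hwA (le_sup_right.trans hE)
      · have h2 := (min_le_iff.1 h1).resolve_right hE
        refine ⟨⟨hwA, .inr ?_⟩, .inr ⟨hD, ?_⟩⟩
        · simp only [upd, if_neg hE]
          exact h2
        · simp only [upd, if_neg hE]
          omega
  obtain ⟨τ, hτ⟩ := exists_minStrategy_of_memory upd (N v c, c) move hmove
  refine iInf_le_of_le τ (iSup_le fun σ => ?_)
  obtain ⟨m, hm0, hmsucc, hmmove⟩ := hτ v σ
  set π := outcome v σ τ with hπ
  have hInv : ∀ i, Inv (m i) (π i) := by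
    intro i
    induction i with
    | zero => rw [hm0]; exact ⟨hv, .inr (hN v c hv hc)⟩
    | succ i ih =>
      rw [hmsucc]
      exact (hstep _ _ _ ih (edge_outcome _ _ _ _) (hmmove i)).1
  have hsum : ∀ i, G.prefixPayoff π i + (m i).2 = c := by
    intro i
    induction i with
    | zero => rw [hm0, prefixPayoff_zero, zero_add]
    | succ i ih =>
      rw [hmsucc, prefixPayoff_succ, ← ih]
      simp only [upd]
      ring
  have hnext : ∀ i, 0 ≤ (m (i + 1)).2 ∨
      ¬ G.walkSup f (π i) ≤ (((m i).2 : ℝ) : EReal) ∧ (m (i + 1)).1 < (m i).1 := by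
    intro i
    rw [hmsucc]
    exact (hstep _ _ _ (hInv i) (edge_outcome _ _ _ _) (hmmove i)).2
  have hrec : ∀ n i, (m i).1 ≤ n → ∃ k > i, 0 ≤ (m k).2 := by
    intro n
    induction n with
    | zero =>
      intro i hi
      exact ⟨i + 1, Nat.lt_succ_self i, (hnext i).resolve_right fun h => by omega⟩
    | succ n ih =>
      intro i hi
      rcases hnext i with h | h
      · exact ⟨i + 1, Nat.lt_succ_self i, h⟩
      · obtain ⟨k, hk, hk'⟩ := ih (i + 1) (by omega)
        exact ⟨k, by omega, hk'⟩
  refine Filter.liminf_le_of_frequently_le ?_ (by isBoundedDefault)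
  refine Filter.frequently_atTop.2 fun i => ?_
  obtain ⟨k, hk, hk'⟩ := hrec _ i le_rfl
  refine ⟨k, hk.le, coe_int_le.2 ?_⟩
  have := hsum k
  omega

end UpperBound

/-! ### The value of the total-payoff game -/

/-- The total-payoff game is determined. Its values are `⊤`, or bounded by the greatest possible
weight of a simple path, and they have a certificate and bound the values of all layers. -/
theorem exists_value_totalPayoff {V : Type*} [Fintype V] (G : WeightedGraph V) :
    ∃ (Y : V → EReal) (g : V → V), G.IsCertificate g Y ∧
      (∀ v, G.lowerValue G.totalPayoff v = Y v ∧ G.upperValue G.totalPayoff v = Y v) ∧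
      (∀ v, IsExtInt (Y v)) ∧ (∀ j v, G.layerValue j v ≤ Y v) ∧
      ∀ v, Y v ≠ ⊤ → Y v ≤ (((G.pathBound : ℤ) : ℝ) : EReal) := by
  classical
  obtain ⟨A, f, hf, hAmax, hAmin, hpos, hneg⟩ := exists_cycle_partition G
  have hsup : ∀ v, v ∉ A → G.walkSup f v ≤ (((G.pathBound : ℤ) : ℝ) : EReal) :=
    fun v hv => walkSup_le hAmin hneg hv
  have hY : ∀ v, v ∉ A → G.limitValue A v ≤ (((G.pathBound : ℤ) : ℝ) : EReal) :=
    fun v hv => limitValue_le hv fun j => (layerValue_le_walkSup hf j v).trans (hsup v hv)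
  have hYt : ∀ v, v ∉ A → G.limitValue A v ≠ ⊤ :=
    fun v hv h => EReal.coe_ne_top _ (top_le_iff.1 (h ▸ hY v hv))
  obtain ⟨g, hg⟩ := exists_isCertificate hf hAmax hpos hYt
  have hlow : ∀ v, G.limitValue A v ≤ G.lowerValue G.totalPayoff v := fun v => by
    by_cases hb : G.limitValue A v = ⊥
    · rw [hb]; exact bot_le
    · exact (isExtInt_limitValue v).le_of_forall_le hb fun c hc => hg.le_lowerValue_totalPayoff hc
  have hstable : ∀ v, ∃ j, v ∉ A → G.layerValue j v = G.limitValue A v := fun v => by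
    by_cases hv : v ∈ A
    · exact ⟨0, fun h => absurd hv h⟩
    · obtain ⟨j, hj⟩ := exists_layerValue_eq hv (hYt v hv)
      exact ⟨j, fun _ => hj⟩
  choose r hr using hstable
  let C := G.pathBound + G.maxAbsWeight + 1
  let J := Finset.univ.sup r ⊔ Fintype.card V * (G.pathBound + C)
  have hJ : ∀ j ≥ J, ∀ v, v ∉ A → G.layerValue j v = G.limitValue A v := by
    intro j hj v hv
    refine le_antisymm (layerValue_le_limitValue A j v) ((hr v hv).ge.trans ?_)
    refine layerValue_mono ?_ v
    exact (Finset.le_sup (f := r) (Finset.mem_univ v)).trans (le_sup_left.trans hj)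
  have hup : ∀ v, G.upperValue G.totalPayoff v ≤ G.limitValue A v := fun v => by
    by_cases hv : v ∈ A
    · rw [limitValue_of_mem hv]; exact le_top
    · refine (isExtInt_limitValue v).le_of_forall_ge (hYt v hv) fun c hc => ?_
      refine upperValue_totalPayoff_le hf hAmin hsup J
        (fun w hw => (hJ J le_rfl w hw).trans (hJ _ (Nat.le_succ J) w hw).symm)
        (fun w hw => ?_) hv ((hJ J le_rfl v hv).le.trans hc)
      have hc' : (((G.pathBound + G.maxAbsWeight + 1 : ℤ) : ℝ) : EReal) ≤ G.limitValue A w := by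
        rw [limitValue_of_mem hw]; exact le_top
      exact hg.le_layerValue (C := C) hc' (by simp [C]) (by simp [C]) le_sup_right
  refine ⟨G.limitValue A, g, hg, fun v => ?_, isExtInt_limitValue, layerValue_le_limitValue A,
    fun v hv => ?_⟩
  · exact ⟨le_antisymm ((lowerValue_le_upperValue _ v).trans (hup v)) (hlow v),
      le_antisymm (hup v) ((hlow v).trans (lowerValue_le_upperValue _ v))⟩
  · exact hY v fun h => hv (limitValue_of_mem h)

end WeightedGraph

open WeightedGraph in
theorem mainTheorem3 {V : Type*} [Fintype V] (G : WeightedGraph V) (k : ℕ)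
    (hk : G.layerBound ≤ k) :
    G.Determined G.totalPayoff ∧
    (G.layered k).Determined (G.layeredPayoff k) ∧
    ∀ v : V,
      (G.value G.totalPayoff v ≠ ⊤ ↔
        G.value G.totalPayoff v = (G.layered k).value (G.layeredPayoff k) (G.topCopy v hk)) ∧
      (G.value G.totalPayoff v = ⊤ ↔
        (((((Fintype.card V : ℝ) - 1) * (G.maxAbsWeight : ℝ) + 1 : ℝ)) : EReal) ≤
          (G.layered k).value (G.layeredPayoff k) (G.topCopy v hk)) := by
  obtain ⟨Y, g, hg, hval, hint, hle, hbound⟩ := exists_value_totalPayoff G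
  refine ⟨fun v => (hval v).1.trans (hval v).2.symm, G.determined_layered, fun v => ?_⟩
  have hcard : 1 ≤ Fintype.card V := Fintype.card_pos_iff.2 ⟨v⟩
  have hreal : (((Fintype.card V : ℝ) - 1) * (G.maxAbsWeight : ℝ) + 1 : ℝ) =
      ((G.pathBound + 1 : ℤ) : ℝ) := by
    push_cast [Nat.cast_sub hcard]; ring
  have hvalue : G.value G.totalPayoff v = Y v := (hval v).1
  have hlayer : (G.layered k).value (G.layeredPayoff k) (G.topCopy v hk) = G.layerValue k v :=
    G.value_layered _
  rw [hvalue, hlayer, hreal]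
  -- `K` layers suffice for all thresholds up to the bound for the finite values, plus one.
  have hK : ∀ c : ℤ, ((c : ℝ) : EReal) ≤ Y v → c ≤ G.pathBound + 1 →
      ((c : ℝ) : EReal) ≤ G.layerValue k v := by
    intro c hc hcB
    refine hg.le_layerValue (C := G.pathBound + 1) hc (by exact_mod_cast hcB) (by omega)
      (le_trans (le_of_eq ?_) hk)
    rw [layerBound, pathBound]
    ring
  have heq : Y v ≠ ⊤ → Y v = G.layerValue k v := by
    intro ht
    refine le_antisymm ?_ (hle k v)
    by_cases hb : Y v = ⊥
    · rw [hb]; exact bot_le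
    · obtain ⟨c, hc⟩ := (hint v).eq_coe hb ht
      rw [hc]
      have h1 := hbound v ht
      rw [hc, coe_int_le] at h1
      exact hK c hc.ge (by omega)
  refine ⟨⟨heq, fun h ht => (layerValue_lt_top k v).ne (h.symm.trans ht)⟩, fun ht => ?_,
    fun h => ?_⟩
  · exact hK _ (ht ▸ le_top) le_rfl
  · by_contra ht
    have := coe_int_le.1 (h.trans ((hle k v).trans (hbound v ht)))
    omega
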